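/- Let $n\ge 3$, $K_1=\{x\in\mathbb R^n : \max_i|x_i|<1\}$, $$B=K_1\cap\{x_{n-1}>0,\ x_n>0\},\qquad \mathcal N=K_1\cap\{x_{n-1}=0,\ x_n>0\},$$ and let $\sigma$ be the surface measure on $\mathcal N$. Let $\lambda,\Lambda>0$, $q,q_1\in(n-1,\infty]$, $p,p_1\in[2,\infty]$, and let $X\subset B\cup\mathcal N$ be compact. Then there is a constant $C=C(\lambda,\Lambda,p,p_1,q,q_1,n,X,B)>0$ with the following property. Let $a^{ij}\in L^\infty(B)$ $(1\le i,j\le n)$, $c\in L^q(B)$ and $c_1\in L^{q_1}(\mathcal N)$ satisfy $$\sum_{i,j}a^{ij}(x)y_iy_j\ge\lambda|y|^2\quad\text{for a.e. }x\in B\text{ and all }y\in\mathbb R^n,\qquad \sum_{i,j}\|a^{ij}\|_{L^\infty(B)}+\|c\|_{L^q(B)}+\|c_1\|_{L^{q_1}(\mathcal N)}\le\Lambda ,$$ and let $g\in L^q(B)$, $g_1\in L^{q_1}(\mathcal N)$. Let $u\in H^1(B)$, where on $\mathcal N$ we also write $u$ for its trace. Suppose that for all $k\ge0$ and all $\zeta\in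 C_c^\infty(K_1\cap\{x_n>0\})$ with $\zeta\ge0$ the function $v=(u-k)^+\zeta^2$ satisfies $$\int_B\Big(\sum_{i,j}a^{ij}u_{x_i}v_{x_j}+cuv\Big)dx+\int_{\mathcal N}c_1uv\,d\sigma\le\int_B gv\,dx+\int_{\mathcal N}g_1v\,d\sigma .$$ Then $$\sup_{X\cap B}u^++\sup_{X\cap\mathcal N}u^+\le C\left(\|u^+\|_{L^p(B)}+\|u^+\|_{L^{p_1}(\mathcal N)}+\|g_1\|_{L^{q_1}(\mathcal N)}+\|g\|_{L^q(B)}\right),$$ where the suprema are essential suprema with respect to Lebesgue measure and to $\sigma$ respectively, and the right-hand side is $\infty$ if one of the norms of $u^+$ is. -/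

import Mathlib

open MeasureTheory Set Filter Topology
open scoped ENNReal ContDiff

noncomputable section

namespace CornerCube

/-- The Euclidean space `ℝⁿ` of dimension `n = m + 2`, with coordinates `x₁, …, xₙ`. -/
abbrev Space (m : ℕ) : Type := Fin (m + 2) → ℝ

/-- The index of the coordinate `xₙ₋₁`. -/
def idxPen (m : ℕ) : Fin (m + 2) := (Fin.last m).castSucc

/-- The index of the coordinate `xₙ`. -/
def idxLast (m : ℕ) : Fin (m + 2) := Fin.last (m + 1)

/-- The open cube `K₁ = {x | max |xᵢ| < 1}`. -/
def unitCube (m : ℕ) : Set (Space m) := {x | ∀ i, |x i| < 1}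

/-- `B = K₁ ∩ {xₙ > 0, xₙ₋₁ > 0}`. -/
def domB (m : ℕ) : Set (Space m) :=
  unitCube m ∩ {x | 0 < x (idxLast m) ∧ 0 < x (idxPen m)}

/-- The face `N = K₁ ∩ {xₙ₋₁ = 0, xₙ > 0}` of `B`. -/
def faceN (m : ℕ) : Set (Space m) :=
  unitCube m ∩ {x | x (idxPen m) = 0 ∧ 0 < x (idxLast m)}

/-- Lebesgue measure on `B`. -/
def muB (m : ℕ) : Measure (Space m) := volume.restrict (domB m)

/-- The surface measure of the hyperplane `{xₙ₋₁ = 0}`: the image of the Lebesgue measure of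
`ℝⁿ⁻¹` under the isometric embedding that inserts `0` as the coordinate `xₙ₋₁`. -/
def planeMeasure (m : ℕ) : Measure (Space m) :=
  (volume : Measure (Fin (m + 1) → ℝ)).map
    (fun y => (idxPen m).insertNth (α := fun _ => ℝ) 0 y)

/-- The surface measure `σ` on `N`. -/
def sigmaN (m : ℕ) : Measure (Space m) := (planeMeasure m).restrict (faceN m)

/-- Classical partial derivative `∂φ/∂xᵢ`. -/
def pderiv {m : ℕ} (i : Fin (m + 2)) (φ : Space m → ℝ) (x : Space m) : ℝ :=
  fderiv ℝ φ x (Pi.single i 1)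

/-- `φ ∈ C_c^∞(U)` (extended by zero to the whole space). -/
structure IsTestFunction {m : ℕ} (U : Set (Space m)) (φ : Space m → ℝ) : Prop where
  smooth : ContDiff ℝ ∞ φ
  compact : HasCompactSupport φ
  support_subset : tsupport φ ⊆ U

/-- `w` is a weak partial derivative of `u` in the `i`-th direction on the open set `U`. -/
structure IsWeakDeriv {m : ℕ} (U : Set (Space m)) (i : Fin (m + 2)) (u w : Space m → ℝ) :
    Prop where
  locInt : LocallyIntegrableOn u U volume
  locInt_deriv : LocallyIntegrableOn w U volume
  integral_eq : ∀ φ : Space m → ℝ, IsTestFunction U φ →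
    ∫ x in U, u x * pderiv i φ x = - ∫ x in U, w x * φ x

open Classical in
/-- The weak partial derivative `u_{xᵢ}` on `U`; it is unique up to null sets, so that a version
of it is chosen (and `0` if `u` has no weak derivative). -/
def weakDeriv {m : ℕ} (U : Set (Space m)) (i : Fin (m + 2)) (u : Space m → ℝ) : Space m → ℝ :=
  if h : ∃ w, IsWeakDeriv U i u w then h.choose else 0

/-- `u ∈ H¹(U)`. -/
def MemH1 {m : ℕ} (U : Set (Space m)) (u : Space m → ℝ) : Prop :=
  MemLp u 2 (volume.restrict U) ∧
    ∀ i, ∃ w, IsWeakDeriv U i u w ∧ MemLp w 2 (volume.restrict U)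

/-- `T` is the trace on `N` of `u ∈ H¹(B)`: the trace operator is the continuous extension to
`H¹(B)` of the restriction to `N` of functions that are smooth up to the boundary, so `T` is the
`L²(N)`-limit of `φₖ|_N` for some `φₖ`, smooth up to the boundary, with `φₖ → u` in `H¹(B)`. -/
def IsTraceOnN {m : ℕ} (u T : Space m → ℝ) : Prop :=
  MemLp T 2 (sigmaN m) ∧
    ∃ φ : ℕ → Space m → ℝ,
      (∀ k, ContDiff ℝ ∞ (φ k)) ∧
      Tendsto (fun k => eLpNorm (fun x => φ k x - u x) 2 (muB m)) atTop (𝓝 0) ∧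
      (∀ i, Tendsto (fun k =>
        eLpNorm (fun x => pderiv i (φ k) x - weakDeriv (domB m) i u x) 2 (muB m))
        atTop (𝓝 0)) ∧
      Tendsto (fun k => eLpNorm (fun x => φ k x - T x) 2 (sigmaN m)) atTop (𝓝 0)

/-- The truncated test function `(u - k)⁺ ζ²`. -/
def truncTest {m : ℕ} (u : Space m → ℝ) (k : ℝ) (ζ : Space m → ℝ) : Space m → ℝ :=
  fun x => (u x - k)⁺ * ζ x ^ 2

/-- The inequality
`∫_B (a^{ij} u_{xᵢ} v_{xⱼ} + c u v) dx + ∫_N c₁ u v dσ ≤ ∫_B g v dx + ∫_N g₁ v dσ`,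
where the values of `u` and `v` on `N` are those of their traces. -/
def WeakIneq {m : ℕ} (a : Fin (m + 2) → Fin (m + 2) → Space m → ℝ)
    (c c₁ g g₁ u v : Space m → ℝ) : Prop :=
  (∫ x, ((∑ i, ∑ j, a i j x * weakDeriv (domB m) i u x * weakDeriv (domB m) j v x)
        + c x * u x * v x) ∂(muB m))
      + ∫ x, c₁ x * u x * v x ∂(sigmaN m)
    ≤ (∫ x, g x * v x ∂(muB m)) + ∫ x, g₁ x * v x ∂(sigmaN m)

end CornerCube

end

noncomputable section

namespace CornerCube

/-! The proof is De Giorgi's iteration, with n = m + 2, run for the single measure `muBN` (Lebesgue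
measure on B plus surface measure on N), so that interior and boundary terms are estimated together.

Sobolev and trace inequality (`exists_sobolev_const`): for limits of C¹ functions with compact
support in K₁ ∩ {xₙ > 0}, the norm in L^r(`muBN`), r = 2(n-1)/(n-2), is bounded by the L²(B) norms
of the partial derivatives. The exponent r is critical for the trace on N and subcritical inside B.
No extension across N is needed: f(x) is recovered by integrating its derivative from x in a
positive coordinate direction, and such rays stay in {xₙ₋₁ > 0} until they leave the support.

Energy estimate (`caccioppoli`): at levels K ≤ κ ≤ 2K the data g, g₁ act like the zero-order
coefficients g/K, g₁/K, so that all lower-order terms are governed by one function β ≥ |c| + |g|/K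
on B, |c₁| + |g₁|/K on N. Testing requires the weak gradient of (u - κ)⁺ζ², which
`HasH1Trace.truncate_mul` and `HasH1TraceZero.isWeakDeriv` supply.

One step (`exists_iteration_const`): β is bounded in L^s(`muBN`) for some s > n-1. Its part above a
large height T is small in L^(n-1) and is absorbed by the Sobolev norm; the rest is of lower order.
If A is the measure of {u > κ} in the support region of the cutoff, the data contribute K²A^(1-1/s),
and Hölder's inequality on {u > κ} gains a factor A^(1/(n-1)). The total power 1 - 1/s + 1/(n-1)
exceeds 1 precisely because s > n-1.

Levels increasing from K to 2K and sets shrinking to X then give u ≤ 2K on X as soon as ‖u⁺‖₂ ≤ ηK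
and K dominates the norms of g, g₁ (`exists_smallness_const`, `exists_sup_bound`). Since p, p₁ ≥ 2,
a constant multiple of the right-hand side of the theorem is an admissible K. -/

/-- The open set `K₁ ∩ {xₙ > 0}`, in which the test functions are supported. -/
abbrev cubeTop (m : ℕ) : Set (Space m) := unitCube m ∩ {x | 0 < x (idxLast m)}

/-- The sum of Lebesgue measure on `B` and surface measure on `N`. -/
def muBN (m : ℕ) : Measure (Space m) := muB m + sigmaN m

/-! ### The domain and the finiteness of its measures. -/

lemma isOpen_unitCube (m : ℕ) : IsOpen (unitCube m) := by
  simp only [unitCube, ofPred_forall]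
  exact isOpen_iInter_of_finite fun i =>
    isOpen_lt (continuous_abs.comp (continuous_apply i)) continuous_const

lemma isOpen_cubeTop (m : ℕ) : IsOpen (cubeTop m) :=
  (isOpen_unitCube m).inter (isOpen_lt continuous_const (continuous_apply _))

lemma isOpen_domB (m : ℕ) : IsOpen (domB m) :=
  (isOpen_unitCube m).inter ((isOpen_lt continuous_const (continuous_apply _)).inter
    (isOpen_lt continuous_const (continuous_apply _)))

lemma measurableSet_domB (m : ℕ) : MeasurableSet (domB m) := (isOpen_domB m).measurableSet

lemma measurableSet_faceN (m : ℕ) : MeasurableSet (faceN m) :=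
  (isOpen_unitCube m).measurableSet.inter
    ((isClosed_eq (continuous_apply _) continuous_const).measurableSet.inter
      (isOpen_lt continuous_const (continuous_apply _)).measurableSet)

lemma domB_eq (m : ℕ) : domB m = cubeTop m ∩ {x | 0 < x (idxPen m)} := by
  ext x; simp [domB, cubeTop, and_assoc]

lemma disjoint_domB_faceN (m : ℕ) : Disjoint (domB m) (faceN m) := by
  rw [Set.disjoint_left]
  intro x hx hx'
  exact hx.2.2.ne' hx'.2.1

lemma continuous_insertNth_pen (m : ℕ) (t : ℝ) :
    Continuous fun y : Fin (m + 1) → ℝ => (idxPen m).insertNth (α := fun _ => ℝ) t y :=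
  continuous_const.finInsertNth _ continuous_id

lemma volume_unitCube_lt_top (m : ℕ) : volume (unitCube m) < ⊤ := by
  have : unitCube m ⊆ Set.Icc (fun _ => -1) (fun _ => 1) := fun x hx =>
    ⟨fun i => (abs_lt.1 (hx i)).1.le, fun i => (abs_lt.1 (hx i)).2.le⟩
  exact (measure_mono this).trans_lt isCompact_Icc.measure_lt_top

instance (m : ℕ) : IsFiniteMeasure (muB m) := by
  refine ⟨?_⟩
  rw [muB, Measure.restrict_apply_univ]
  exact (measure_mono inter_subset_left).trans_lt (volume_unitCube_lt_top m)

instance (m : ℕ) : IsFiniteMeasure (sigmaN m) := by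
  refine ⟨?_⟩
  rw [sigmaN, Measure.restrict_apply_univ, planeMeasure,
    Measure.map_apply (continuous_insertNth_pen m 0).measurable (measurableSet_faceN m)]
  have : (fun y : Fin (m + 1) → ℝ => (idxPen m).insertNth (α := fun _ => ℝ) 0 y) ⁻¹' faceN m
      ⊆ Set.Icc (fun _ => -1) (fun _ => 1) := by
    intro y hy
    have h := fun i => hy.1 ((idxPen m).succAbove i)
    simp only [Fin.insertNth_apply_succAbove] at h
    exact ⟨fun i => (abs_lt.1 (h i)).1.le, fun i => (abs_lt.1 (h i)).2.le⟩
  exact (measure_mono this).trans_lt isCompact_Icc.measure_lt_top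

instance (m : ℕ) : IsFiniteMeasure (muBN m) := by
  unfold muBN; infer_instance

/-! ### Sobolev and trace inequalities in L¹. -/

/-- A compactly supported `C¹` function on the line is bounded by the integral of its derivative
to the right. -/
lemma enorm_le_lintegral_Ioi_deriv {f : ℝ → ℝ} (hf : ContDiff ℝ 1 f) (h'f : HasCompactSupport f)
    (x : ℝ) : ‖f x‖ₑ ≤ ∫⁻ y in Ioi x, ‖deriv f y‖ₑ := by
  have h := HasCompactSupport.integral_Ioi_deriv_eq hf h'f x
  calc ‖f x‖ₑ = ‖∫ y in Ioi x, deriv f y‖ₑ := by rw [h, enorm_neg]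
    _ ≤ _ := enorm_integral_le_lintegral_enorm _

/-- The ray is taken in the positive direction on purpose: starting in {xₙ₋₁ ≥ 0}, its later points
never leave that half space, so only derivatives over the half space enter when this is applied. -/
lemma enorm_le_lintegral_update {ι : Type*} [Fintype ι] [DecidableEq ι] {f : (ι → ℝ) → ℝ}
    (hf : ContDiff ℝ 1 f) (hc : HasCompactSupport f) (x : ι → ℝ) (i : ι) :
    ‖f x‖ₑ ≤ ∫⁻ t in Ioi (x i), ‖fderiv ℝ f (Function.update x i t)‖ₑ := by
  calc ‖f x‖ₑ
    _ ≤ ∫⁻ t in Ioi (x i), ‖deriv (f ∘ Function.update x i) t‖ₑ := by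
        apply le_trans (by simp) (enorm_le_lintegral_Ioi_deriv _ _ _)
        · exact hf.comp (by convert! contDiff_update 1 x i)
        · exact hc.comp_isClosedEmbedding (isClosedEmbedding_update x i)
    _ ≤ _ := by
      refine lintegral_mono fun t => ?_
      calc ‖deriv (f ∘ Function.update x i) t‖ₑ
          = ‖fderiv ℝ f (Function.update x i t) (deriv (Function.update x i) t)‖ₑ := by
            rw [fderiv_comp_deriv _ (hf.differentiable one_ne_zero).differentiableAt
              (hasDerivAt_update x i t).differentiableAt]
        _ ≤ ‖fderiv ℝ f (Function.update x i t)‖ₑ * ‖deriv (Function.update x i) t‖ₑ :=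
            ContinuousLinearMap.le_opENorm _ _
        _ ≤ ‖fderiv ℝ f (Function.update x i t)‖ₑ := by simp [deriv_update, Pi.enorm_single]

/-- The integral of `‖Df‖` over the half space `{xₙ₋₁ > 0}` is that over `B`. -/
lemma lintegral_indicator_fderiv {m : ℕ} {f : Space m → ℝ} (hs : tsupport f ⊆ cubeTop m) :
    ∫⁻ x, ({x : Space m | 0 < x (idxPen m)}.indicator (fun x => ‖fderiv ℝ f x‖ₑ)) x
      = ∫⁻ x, ‖fderiv ℝ f x‖ₑ ∂(muB m) := by
  rw [muB, ← lintegral_indicator (measurableSet_domB m)]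
  refine lintegral_congr fun x => ?_
  by_cases hx : x ∈ tsupport f
  · have hU := hs hx
    simp only [indicator, domB_eq, mem_inter_iff, hU, true_and]
  · have : ‖fderiv ℝ f x‖ₑ = 0 := by
      have h0 : fderiv ℝ f x = 0 := by
        by_contra h
        exact hx (support_fderiv_subset ℝ h)
      rw [← ofReal_norm, h0, norm_zero, ENNReal.ofReal_zero]
    simp only [indicator, this, ite_self]

/-- The trace inequality in `L¹`. -/
lemma lintegral_sigmaN_le {m : ℕ} {f : Space m → ℝ} (hf : ContDiff ℝ 1 f)
    (hc : HasCompactSupport f) (hs : tsupport f ⊆ cubeTop m) :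
    ∫⁻ x, ‖f x‖ₑ ∂(sigmaN m) ≤ ∫⁻ x, ‖fderiv ℝ f x‖ₑ ∂(muB m) := by
  have hm1 : Measurable fun x => ‖f x‖ₑ := hf.continuous.measurable.enorm
  have hm2 : Measurable fun x => ‖fderiv ℝ f x‖ₑ :=
    (hf.continuous_fderiv one_ne_zero).measurable.enorm
  have hH : MeasurableSet {x : Space m | 0 < x (idxPen m)} :=
    (isOpen_lt continuous_const (continuous_apply _)).measurableSet
  calc ∫⁻ x, ‖f x‖ₑ ∂(sigmaN m) ≤ ∫⁻ x, ‖f x‖ₑ ∂(planeMeasure m) :=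
        lintegral_mono' Measure.restrict_le_self le_rfl
    _ = ∫⁻ y : Fin (m + 1) → ℝ, ‖f ((idxPen m).insertNth (α := fun _ => ℝ) 0 y)‖ₑ := by
        rw [planeMeasure, lintegral_map hm1 (continuous_insertNth_pen m 0).measurable]
    _ ≤ ∫⁻ y : Fin (m + 1) → ℝ, ∫⁻ t : ℝ,
          ({x : Space m | 0 < x (idxPen m)}.indicator (fun x => ‖fderiv ℝ f x‖ₑ))
            ((idxPen m).insertNth (α := fun _ => ℝ) t y) := by
        refine lintegral_mono fun y => ?_
        -- The ray starts on the face and runs perpendicular to it, so integrating over the starting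
        -- points sweeps out the half space {xₙ₋₁ > 0}.
        refine (enorm_le_lintegral_update hf hc _ (idxPen m)).trans ?_
        rw [← lintegral_indicator measurableSet_Ioi]
        refine lintegral_mono fun t => ?_
        simp [indicator, Fin.update_insertNth]
    _ = ∫⁻ z : ℝ × (Fin (m + 1) → ℝ),
          ({x : Space m | 0 < x (idxPen m)}.indicator (fun x => ‖fderiv ℝ f x‖ₑ))
            ((MeasurableEquiv.piFinSuccAbove (fun _ => ℝ) (idxPen m)).symm z) := by
        rw [Measure.volume_eq_prod, lintegral_prod_symm _ _]
        · rfl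
        · exact ((hm2.indicator hH).comp (MeasurableEquiv.measurable _)).aemeasurable
    _ = _ := by
        rw [(volume_preserving_piFinSuccAbove (fun _ => ℝ) (idxPen m)).symm.lintegral_comp
          (hm2.indicator hH), lintegral_indicator_fderiv hs]

/-- The Gagliardo–Nirenberg–Sobolev inequality in `W^{1,1}(B)`. -/
lemma lintegral_muB_pow_le {m : ℕ} {f : Space m → ℝ} (hf : ContDiff ℝ 1 f)
    (hc : HasCompactSupport f) (hs : tsupport f ⊆ cubeTop m) :
    ∫⁻ x, ‖f x‖ₑ ^ (((m : ℝ) + 2) / (m + 1)) ∂(muB m)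
      ≤ (∫⁻ x, ‖fderiv ℝ f x‖ₑ ∂(muB m)) ^ (((m : ℝ) + 2) / (m + 1)) := by
  have hm2 : Measurable fun x => ‖fderiv ℝ f x‖ₑ :=
    (hf.continuous_fderiv one_ne_zero).measurable.enorm
  have hH : MeasurableSet {x : Space m | 0 < x (idxPen m)} :=
    (isOpen_lt continuous_const (continuous_apply _)).measurableSet
  have hcard : ((Fintype.card (Fin (m + 2)) : ℕ) : ℝ) = (m : ℝ) + 2 := by simp
  have hp : Real.HolderConjugate (Fintype.card (Fin (m + 2)) : ℝ) (((m : ℝ) + 2) / (m + 1)) := by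
    rw [hcard, Real.holderConjugate_iff]
    refine ⟨by linarith [(Nat.cast_nonneg m : (0 : ℝ) ≤ m)], ?_⟩
    field_simp
    ring
  -- The grid-lines (Loomis–Whitney type) inequality, applied to ‖Df‖ cut off to the half space; its
  -- left side is a product of n line integrals, each of which dominates |f(x)|.
  have key := lintegral_prod_lintegral_pow_le (fun _ : Fin (m + 2) => (volume : Measure ℝ)) hp
    (hm2.indicator hH)
  rw [← volume_pi, lintegral_indicator_fderiv hs] at key
  refine le_trans ?_ key
  rw [muB, ← lintegral_indicator (measurableSet_domB m)]
  refine lintegral_mono fun x => ?_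
  by_cases hx : x ∈ domB m
  · rw [indicator_of_mem hx]
    have e1 : ‖f x‖ₑ ^ (((m : ℝ) + 2) / (m + 1))
        = ∏ _i : Fin (m + 2), ‖f x‖ₑ ^ ((1 : ℝ) / (Fintype.card (Fin (m + 2)) - 1 : ℝ)) := by
      rw [Finset.prod_const, Finset.card_univ, ← ENNReal.rpow_natCast, ← ENNReal.rpow_mul, hcard]
      congr 1
      rw [show (m : ℝ) + 2 - 1 = m + 1 by ring]
      field_simp
    rw [e1]
    refine Finset.prod_le_prod' fun i _ => ?_
    have h0 : (0 : ℝ) ≤ 1 / (Fintype.card (Fin (m + 2)) - 1 : ℝ) := by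
      rw [hcard]
      exact div_nonneg zero_le_one (by linarith [(Nat.cast_nonneg m : (0 : ℝ) ≤ m)])
    refine ENNReal.rpow_le_rpow ?_ h0
    refine (enorm_le_lintegral_update hf hc x i).trans ?_
    rw [← lintegral_indicator measurableSet_Ioi]
    refine lintegral_mono fun t => ?_
    by_cases ht : t ∈ Ioi (x i)
    · rw [indicator_of_mem ht, indicator_of_mem]
      simp only [mem_ofPred_eq]
      -- The ray from x ∈ B stays in the half space: either its coordinate xₙ₋₁ increases from a
      -- positive value, or it does not change.
      rcases eq_or_ne (idxPen m) i with h | h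
      · subst h
        simpa using hx.2.2.trans ht
      · rw [Function.update_of_ne h]
        exact hx.2.2
    · simp [indicator_of_notMem ht]
  · simp [indicator_of_notMem hx]

/-! ### Sobolev and trace inequalities in L². -/

/-- The critical exponent `2 (n - 1) / (n - 2)` of the trace embedding. -/
def traceExp (m : ℕ) : ℝ := 2 * (m + 1) / m

lemma traceExp_gt_two {m : ℕ} (hm : 1 ≤ m) : 2 < traceExp m := by
  have : (1 : ℝ) ≤ m := by exact_mod_cast hm
  rw [traceExp, lt_div_iff₀ (by linarith)]
  linarith

/-- The L¹ theory applied to |f|^r. With J the left side, Cauchy–Schwarz gives J ≤ r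
(∫|f|^(2(r-1)))^(1/2) ‖Df‖₂, and since 2(r-1) = r·n/(n-1), the L¹ Sobolev inequality bounds that
integral by J^(n/(n-1)). Dividing by the power of J leaves J^(1/r). -/
lemma lintegral_fderiv_rpow_le {m : ℕ} (hm : 1 ≤ m) {f : Space m → ℝ} (hf : ContDiff ℝ 1 f)
    (hc : HasCompactSupport f) (hs : tsupport f ⊆ cubeTop m) :
    ∫⁻ x, ‖fderiv ℝ (fun x => ‖f x‖ ^ traceExp m) x‖ₑ ∂(muB m) ≤
      ENNReal.ofReal (traceExp m) ^ traceExp m *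
        (∫⁻ x, ‖fderiv ℝ f x‖ₑ ^ (2 : ℝ) ∂(muB m)) ^ (traceExp m / 2) := by
  have hm' : (1 : ℝ) ≤ m := by exact_mod_cast hm
  have hr := traceExp_gt_two hm
  set r := traceExp m with hrdef
  set F : Space m → ℝ := fun x => ‖f x‖ ^ r with hF
  have hFd : ContDiff ℝ 1 F := hf.norm_rpow (by linarith)
  have hsub : tsupport F ⊆ tsupport f := by
    refine closure_mono fun x hx => ?_
    simp only [Function.mem_support, hF] at hx ⊢
    intro h
    apply hx
    rw [h, norm_zero, Real.zero_rpow (by linarith)]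
  have hFc : HasCompactSupport F := hc.mono' (subset_closure.trans hsub)
  set J := ∫⁻ x, ‖fderiv ℝ F x‖ₑ ∂(muB m) with hJ
  set D := ∫⁻ x, ‖fderiv ℝ f x‖ₑ ^ (2 : ℝ) ∂(muB m) with hD
  -- Finiteness of J is what permits the later cancellation of a power of it.
  have hJtop : J ≠ ⊤ := by
    have : Integrable (fderiv ℝ F) volume :=
      (hFd.continuous_fderiv one_ne_zero).integrable_of_hasCompactSupport (hFc.fderiv ℝ)
    exact (this.restrict (s := domB m)).2.ne
  have hmf : Measurable fun x => ‖f x‖ₑ := hf.continuous.measurable.enorm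
  have hmDf : Measurable fun x => ‖fderiv ℝ f x‖ₑ :=
    (hf.continuous_fderiv one_ne_zero).measurable.enorm
  have hA : ∫⁻ x, (‖f x‖ₑ ^ (r - 1)) ^ (2 : ℝ) ∂(muB m) ≤ J ^ (((m : ℝ) + 2) / (m + 1)) := by
    refine le_trans (le_of_eq ?_) (lintegral_muB_pow_le hFd hFc (hsub.trans hs))
    refine lintegral_congr fun x => ?_
    have : ‖F x‖ₑ = ‖f x‖ₑ ^ r := by
      simp only [hF]
      rw [Real.enorm_rpow_of_nonneg (norm_nonneg _) (by linarith), enorm_norm]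
    rw [this, ← ENNReal.rpow_mul, ← ENNReal.rpow_mul]
    congr 1
    rw [hrdef, traceExp]
    field_simp
    ring
  have h1 : J ≤ ENNReal.ofReal r * (J ^ (((m : ℝ) + 2) / (2 * (m + 1))) * D ^ (1 / 2 : ℝ)) := by
    calc J ≤ ∫⁻ x, ENNReal.ofReal r * (‖f x‖ₑ ^ (r - 1) * ‖fderiv ℝ f x‖ₑ) ∂(muB m) := by
          refine lintegral_mono fun x => ?_
          have := enorm_fderiv_norm_rpow_le (hf.differentiable one_ne_zero) (x := x)
            (p := r.toNNReal) (by rw [Real.lt_toNNReal_iff_coe_lt]; simp; linarith)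
          rw [Real.coe_toNNReal _ (by linarith)] at this
          rw [← mul_assoc]
          exact this
      _ = ENNReal.ofReal r * ∫⁻ x, (‖f x‖ₑ ^ (r - 1) * ‖fderiv ℝ f x‖ₑ) ∂(muB m) :=
          lintegral_const_mul _ ((hmf.pow_const _).mul hmDf)
      _ ≤ _ := by
          gcongr
          refine (ENNReal.lintegral_mul_le_Lp_mul_Lq _ Real.HolderConjugate.two_two
            (hmf.pow_const _).aemeasurable hmDf.aemeasurable).trans ?_
          refine mul_le_mul_left ?_ _
          refine (ENNReal.rpow_le_rpow hA (by norm_num)).trans (le_of_eq ?_)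
          rw [← ENNReal.rpow_mul]
          congr 1
          field_simp
  rcases eq_or_ne J 0 with h0 | h0
  · rw [h0]; exact zero_le
  have h2 : J ^ (1 / r) ≤ ENNReal.ofReal r * D ^ (1 / 2 : ℝ) := by
    have e : J = J ^ (1 / r) * J ^ (((m : ℝ) + 2) / (2 * (m + 1))) := by
      rw [← ENNReal.rpow_add _ _ h0 hJtop]
      have : 1 / r + ((m : ℝ) + 2) / (2 * (m + 1)) = 1 := by
        rw [hrdef, traceExp]
        field_simp
        ring
      rw [this, ENNReal.rpow_one]
    have hpos : J ^ (((m : ℝ) + 2) / (2 * (m + 1))) ≠ 0 := by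
      simp [h0, hJtop]
    have htop : J ^ (((m : ℝ) + 2) / (2 * (m + 1))) ≠ ⊤ :=
      ENNReal.rpow_ne_top_of_nonneg (by positivity) hJtop
    refine (ENNReal.mul_le_mul_iff_left hpos htop).1 ?_
    rw [← e]
    calc J ≤ _ := h1
      _ = _ := by ring
  calc J = (J ^ (1 / r)) ^ r := by
        rw [← ENNReal.rpow_mul, one_div, inv_mul_cancel₀ (by linarith), ENNReal.rpow_one]
    _ ≤ (ENNReal.ofReal r * D ^ (1 / 2 : ℝ)) ^ r := ENNReal.rpow_le_rpow h2 (by linarith)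
    _ = _ := by
        rw [ENNReal.mul_rpow_of_nonneg _ _ (by linarith), ← ENNReal.rpow_mul]
        congr 2
        ring

/-- The Sobolev and trace inequalities for `C¹` functions. -/
lemma exists_lintegral_muBN_le {m : ℕ} (hm : 1 ≤ m) :
    ∃ C : ℝ≥0∞, C ≠ ⊤ ∧ ∀ f : Space m → ℝ, ContDiff ℝ 1 f → HasCompactSupport f →
      tsupport f ⊆ cubeTop m →
      ∫⁻ x, ‖f x‖ₑ ^ traceExp m ∂(muBN m)
        ≤ C * (∫⁻ x, ‖fderiv ℝ f x‖ₑ ^ (2 : ℝ) ∂(muB m)) ^ (traceExp m / 2) := by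
  have hr := traceExp_gt_two hm
  have hm' : (1 : ℝ) ≤ m := by exact_mod_cast hm
  refine ⟨(muB m univ ^ (1 / ((m : ℝ) + 2)) + 1) * ENNReal.ofReal (traceExp m) ^ traceExp m, ?_, ?_⟩
  · refine ENNReal.mul_ne_top (ENNReal.add_ne_top.2 ⟨?_, ENNReal.one_ne_top⟩) ?_
    · exact ENNReal.rpow_ne_top_of_nonneg (by positivity) (measure_ne_top _ _)
    · exact ENNReal.rpow_ne_top_of_nonneg (by linarith) ENNReal.ofReal_ne_top
  intro f hf hc hs
  set r := traceExp m with hrdef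
  set F : Space m → ℝ := fun x => ‖f x‖ ^ r with hF
  have hFd : ContDiff ℝ 1 F := hf.norm_rpow (by linarith)
  have hsub : tsupport F ⊆ tsupport f := by
    refine closure_mono fun x hx => ?_
    simp only [Function.mem_support, hF] at hx ⊢
    intro h
    apply hx
    rw [h, norm_zero, Real.zero_rpow (by linarith)]
  have hFc : HasCompactSupport F := hc.mono' (subset_closure.trans hsub)
  have hFe : ∀ x, ‖f x‖ₑ ^ r = ‖F x‖ₑ := fun x => by
    simp only [hF]
    rw [Real.enorm_rpow_of_nonneg (norm_nonneg _) (by linarith), enorm_norm]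
  have hJ := lintegral_fderiv_rpow_le hm hf hc hs
  rw [← hrdef] at hJ
  set J := ∫⁻ x, ‖fderiv ℝ F x‖ₑ ∂(muB m)
  -- In B the exponent r is not critical: Hölder's inequality against the constant 1, with exponents
  -- n and n/(n-1), costs only a power of the volume.
  have hB : ∫⁻ x, ‖F x‖ₑ ∂(muB m) ≤ muB m univ ^ (1 / ((m : ℝ) + 2)) * J := by
    have hconj : Real.HolderConjugate ((m : ℝ) + 2) (((m : ℝ) + 2) / (m + 1)) := by
      rw [Real.holderConjugate_iff]
      refine ⟨by linarith, ?_⟩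
      field_simp
      ring
    have := ENNReal.lintegral_mul_le_Lp_mul_Lq (muB m) hconj
      (aemeasurable_const (b := (1 : ℝ≥0∞))) hFd.continuous.measurable.enorm.aemeasurable
    simp only [Pi.mul_apply, one_mul, ENNReal.one_rpow, lintegral_one] at this
    refine this.trans ?_
    gcongr
    refine (ENNReal.rpow_le_rpow (lintegral_muB_pow_le hFd hFc (hsub.trans hs))
      (by positivity)).trans (le_of_eq ?_)
    rw [← ENNReal.rpow_mul, mul_one_div_cancel (by positivity), ENNReal.rpow_one]
  calc ∫⁻ x, ‖f x‖ₑ ^ r ∂(muBN m) = ∫⁻ x, ‖F x‖ₑ ∂(muB m) + ∫⁻ x, ‖F x‖ₑ ∂(sigmaN m) := by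
        rw [muBN, lintegral_add_measure]
        simp only [hFe]
    _ ≤ muB m univ ^ (1 / ((m : ℝ) + 2)) * J + J :=
        add_le_add hB (lintegral_sigmaN_le hFd hFc (hsub.trans hs))
    _ = (muB m univ ^ (1 / ((m : ℝ) + 2)) + 1) * J := by ring
    _ ≤ _ := by
        rw [mul_assoc]
        gcongr

/-- The Sobolev and trace inequalities for `C¹` functions, in terms of partial derivatives. -/
lemma exists_eLpNorm_muBN_le {m : ℕ} (hm : 1 ≤ m) :
    ∃ C : ℝ≥0∞, C ≠ ⊤ ∧ ∀ f : Space m → ℝ, ContDiff ℝ 1 f → HasCompactSupport f →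
      tsupport f ⊆ cubeTop m →
      eLpNorm f (ENNReal.ofReal (traceExp m)) (muBN m)
        ≤ C * ∑ i, eLpNorm (pderiv i f) 2 (muB m) := by
  obtain ⟨C, hC, h⟩ := exists_lintegral_muBN_le hm
  have hr := traceExp_gt_two hm
  refine ⟨C ^ (1 / traceExp m), ENNReal.rpow_ne_top_of_nonneg (by positivity) hC, ?_⟩
  intro f hf hc hs
  have hfd : Continuous (fderiv ℝ f) := hf.continuous_fderiv one_ne_zero
  have e1 : eLpNorm (fderiv ℝ f) 2 (muB m) ≤ ∑ i, eLpNorm (pderiv i f) 2 (muB m) := by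
    have hpm : ∀ i, AEStronglyMeasurable (fun x => ‖pderiv i f x‖) (muB m) := fun i =>
      ((hfd.clm_apply continuous_const).norm).aestronglyMeasurable
    calc eLpNorm (fderiv ℝ f) 2 (muB m)
        ≤ eLpNorm (∑ i, fun x => ‖pderiv i f x‖) 2 (muB m) := by
          refine eLpNorm_mono_real fun x => ?_
          rw [Finset.sum_apply]
          refine ContinuousLinearMap.opNorm_le_bound _ (Finset.sum_nonneg fun i _ => norm_nonneg _)
            fun v => ?_
          have hv : v = ∑ i, v i • (Pi.single i (1 : ℝ) : Space m) := by
            funext j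
            simp [Finset.sum_apply, Pi.single_apply]
          calc ‖fderiv ℝ f x v‖ = ‖∑ i, v i • pderiv i f x‖ := by
                conv_lhs => rw [hv]
                simp [map_sum, pderiv]
            _ ≤ ∑ i, ‖v i • pderiv i f x‖ := norm_sum_le _ _
            _ ≤ ∑ i, ‖pderiv i f x‖ * ‖v‖ := by
                refine Finset.sum_le_sum fun i _ => ?_
                rw [norm_smul, mul_comm]
                exact mul_le_mul_of_nonneg_left (norm_le_pi_norm v i) (norm_nonneg _)
            _ = _ := by rw [Finset.sum_mul]
      _ ≤ ∑ i, eLpNorm (fun x => ‖pderiv i f x‖) 2 (muB m) :=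
          eLpNorm_sum_le (fun i _ => hpm i) (by norm_num)
      _ = _ := by simp only [eLpNorm_norm]
  have hr0 : ENNReal.ofReal (traceExp m) ≠ 0 := by
    simp only [ne_eq, ENNReal.ofReal_eq_zero, not_le]; linarith
  rw [eLpNorm_eq_lintegral_rpow_enorm_toReal hr0 ENNReal.ofReal_ne_top,
    ENNReal.toReal_ofReal (by linarith)]
  calc _ ≤ (C * (∫⁻ x, ‖fderiv ℝ f x‖ₑ ^ (2 : ℝ) ∂(muB m)) ^ (traceExp m / 2)) ^ (1 / traceExp m) :=
        ENNReal.rpow_le_rpow (h f hf hc hs) (by positivity)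
    _ = C ^ (1 / traceExp m) * eLpNorm (fderiv ℝ f) 2 (muB m) := by
        rw [ENNReal.mul_rpow_of_nonneg _ _ (by positivity), ← ENNReal.rpow_mul,
          eLpNorm_eq_lintegral_rpow_enorm_toReal (by norm_num) (by norm_num)]
        have hr' : traceExp m ≠ 0 := by linarith
        congr 2
        simp only [ENNReal.toReal_ofNat]
        field_simp
    _ ≤ _ := by gcongr

/-! ### A C¹ regularisation of the positive part. -/

/-- A `C¹` approximation of the positive part. -/
def softPos (ε t : ℝ) : ℝ := max t 0 - ε + ε ^ 2 / (max t 0 + ε)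

/-- The derivative of `softPos ε`. -/
def softPosDeriv (ε t : ℝ) : ℝ := 1 - (ε / (max t 0 + ε)) ^ 2

lemma continuous_softPosDeriv {ε : ℝ} (hε : 0 < ε) : Continuous (softPosDeriv ε) := by
  unfold softPosDeriv
  refine continuous_const.sub ((continuous_const.div (by fun_prop) fun t => ?_).pow 2)
  have := le_max_right t 0
  positivity

lemma hasDerivAt_softPos {ε : ℝ} (hε : 0 < ε) (t : ℝ) :
    HasDerivAt (softPos ε) (softPosDeriv ε t) t := by
  have hne : ∀ y : ℝ, y ≠ 0 → HasDerivAt (softPos ε) (softPosDeriv ε y) y := by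
    intro y hy
    rcases lt_or_gt_of_ne hy with h | h
    · have e : softPos ε =ᶠ[𝓝 y] fun _ => (0 : ℝ) - ε + ε ^ 2 / (0 + ε) := by
        filter_upwards [Iio_mem_nhds h] with z hz
        rw [softPos, max_eq_right (le_of_lt hz)]
      have : softPosDeriv ε y = 0 := by
        rw [softPosDeriv, max_eq_right h.le]; field_simp; ring
      rw [this]
      exact (hasDerivAt_const y _).congr_of_eventuallyEq e
    · have e : softPos ε =ᶠ[𝓝 y] fun z => z - ε + ε ^ 2 / (z + ε) := by
        filter_upwards [Ioi_mem_nhds h] with z hz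
        rw [softPos, max_eq_left (le_of_lt hz)]
      have hd : HasDerivAt (fun z : ℝ => z - ε + ε ^ 2 / (z + ε))
          (1 + (0 * (y + ε) - ε ^ 2 * 1) / (y + ε) ^ 2) y :=
        ((hasDerivAt_id y).sub_const ε).add
          ((hasDerivAt_const y (ε ^ 2)).div ((hasDerivAt_id y).add_const ε) (by simp; linarith))
      refine (hd.congr_of_eventuallyEq e).congr_deriv ?_
      rw [softPosDeriv, max_eq_left h.le, div_pow]
      ring
  rcases eq_or_ne t 0 with rfl | h
  -- At 0 the one-sided formulas are glued by continuity of the function and of the candidate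
  -- derivative.
  · refine hasDerivAt_of_hasDerivAt_of_ne hne ?_ (continuous_softPosDeriv hε).continuousAt
    have : Continuous (softPos ε) := by
      unfold softPos
      refine Continuous.add (by fun_prop) (continuous_const.div (by fun_prop) fun t => ?_)
      have := le_max_right t 0
      positivity
    exact this.continuousAt
  · exact hne t h

lemma softPosDeriv_mem {ε : ℝ} (hε : 0 < ε) (t : ℝ) : |softPosDeriv ε t| ≤ 1 := by
  have h0 := le_max_right t 0
  have h1 : ε / (max t 0 + ε) ≤ 1 := by rw [div_le_one (by linarith)]; linarith
  have h2 : 0 ≤ ε / (max t 0 + ε) := by positivity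
  rw [softPosDeriv, abs_le]
  constructor <;> nlinarith

lemma contDiff_softPos {ε : ℝ} (hε : 0 < ε) : ContDiff ℝ 1 (softPos ε) := by
  rw [contDiff_one_iff_deriv]
  refine ⟨fun t => (hasDerivAt_softPos hε t).differentiableAt, ?_⟩
  rw [show deriv (softPos ε) = softPosDeriv ε from funext fun t => (hasDerivAt_softPos hε t).deriv]
  exact continuous_softPosDeriv hε

lemma abs_softPos_sub_le {ε : ℝ} (hε : 0 < ε) (t : ℝ) : |softPos ε t - max t 0| ≤ ε := by
  have h0 := le_max_right t 0
  have h1 : ε ^ 2 / (max t 0 + ε) ≤ ε := by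
    rw [div_le_iff₀ (by linarith)]; nlinarith
  have h2 : 0 ≤ ε ^ 2 / (max t 0 + ε) := by positivity
  rw [softPos, abs_le]
  constructor <;> linarith

lemma abs_softPos_sub_softPos_le {ε : ℝ} (hε : 0 < ε) (s t : ℝ) :
    |softPos ε s - softPos ε t| ≤ |s - t| := by
  have := Convex.norm_image_sub_le_of_norm_hasDerivWithin_le (f := softPos ε)
    (f' := softPosDeriv ε) (C := 1) (s := univ) (x := t) (y := s)
    (fun x _ => (hasDerivAt_softPos hε x).hasDerivWithinAt)
    (fun x _ => by simpa using softPosDeriv_mem hε x) convex_univ (mem_univ _) (mem_univ _)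
  simpa using this

/-- The limit is 0 at t = 0 as well, so the truncated gradient has an explicit version and nothing
need be known about the gradient of u on {u = κ}. -/
lemma tendsto_softPosDeriv (t : ℝ) {e : ℕ → ℝ} (he : ∀ k, 0 < e k) (he0 : Tendsto e atTop (𝓝 0)) :
    Tendsto (fun k => softPosDeriv (e k) t) atTop (𝓝 (if 0 < t then 1 else 0)) := by
  split_ifs with h
  · have h1 : Tendsto (fun k => 1 - (e k / (max t 0 + e k)) ^ 2) atTop
        (𝓝 (1 - (0 / (max t 0 + 0)) ^ 2)) := by
      refine tendsto_const_nhds.sub ((he0.div (tendsto_const_nhds.add he0) ?_).pow 2)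
      rw [max_eq_left h.le]; linarith
    simpa [softPosDeriv] using h1
  · have : ∀ k, softPosDeriv (e k) t = 0 := fun k => by
      have := he k
      rw [softPosDeriv, max_eq_right (not_lt.1 h)]; field_simp; ring
    simp [this]

/-! ### Functions with trace and their truncations. -/

/-- Dominated convergence in `L²`. -/
lemma tendsto_eLpNorm_two_of_dominated {α : Type*} [MeasurableSpace α] {ν : Measure α}
    {F : ℕ → α → ℝ} {g : α → ℝ} (hF : ∀ n, AEStronglyMeasurable (F n) ν) (hg : MemLp g 2 ν)
    (hb : ∀ n, ∀ᵐ x ∂ν, |F n x| ≤ |g x|) (hl : ∀ᵐ x ∂ν, Tendsto (fun n => F n x) atTop (𝓝 0)) :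
    Tendsto (fun n => eLpNorm (F n) 2 ν) atTop (𝓝 0) := by
  have h1 : Tendsto (fun n => ∫⁻ x, ‖F n x‖ₑ ^ (2 : ℝ) ∂ν) atTop (𝓝 (∫⁻ _, 0 ∂ν)) := by
    refine tendsto_lintegral_of_dominated_convergence' (fun x => ‖g x‖ₑ ^ (2 : ℝ))
      (fun n => (hF n).enorm.pow_const _) (fun n => ?_) ?_ ?_
    · filter_upwards [hb n] with x hx
      refine ENNReal.rpow_le_rpow ?_ (by norm_num)
      exact enorm_le_iff_norm_le.2 hx
    · have := lintegral_rpow_enorm_lt_top_of_eLpNorm_lt_top (by norm_num) (by norm_num) hg.2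
      simpa using this.ne
    · filter_upwards [hl] with x hx
      have := (ENNReal.continuous_rpow_const (y := (2 : ℝ))).tendsto _ |>.comp
        ((continuous_enorm.tendsto (0 : ℝ)).comp hx)
      simpa [Function.comp_def] using this
  have h2 := (ENNReal.continuous_rpow_const (y := (1 / 2 : ℝ))).tendsto _ |>.comp h1
  simp only [lintegral_zero] at h2
  rw [ENNReal.zero_rpow_of_pos (by norm_num)] at h2
  refine h2.congr fun n => ?_
  rw [eLpNorm_eq_lintegral_rpow_enorm_toReal (by norm_num) (by norm_num)]
  simp

lemma eLpNorm_two_add_measure_le {α : Type*} [MeasurableSpace α] (μ ν : Measure α) (f : α → ℝ) :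
    eLpNorm f 2 (μ + ν) ≤ eLpNorm f 2 μ + eLpNorm f 2 ν := by
  simp only [eLpNorm_eq_lintegral_rpow_enorm_toReal (two_ne_zero) (ENNReal.ofNat_ne_top),
    lintegral_add_measure, ENNReal.toReal_ofNat]
  exact ENNReal.rpow_add_le_add_rpow _ _ (by norm_num) (by norm_num)

/-- `u` lies in `H¹(B)` with gradient `Du`, its values on `N` being those of its trace. -/
structure HasH1Trace {m : ℕ} (u : Space m → ℝ) (Du : Fin (m + 2) → Space m → ℝ) : Prop where
  memLp : MemLp u 2 (muBN m)
  memLp_deriv : ∀ i, MemLp (Du i) 2 (muB m)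
  approx : ∃ φ : ℕ → Space m → ℝ, (∀ k, ContDiff ℝ 1 (φ k)) ∧
    Tendsto (fun k => eLpNorm (φ k - u) 2 (muBN m)) atTop (𝓝 0) ∧
    ∀ i, Tendsto (fun k => eLpNorm (pderiv i (φ k) - Du i) 2 (muB m)) atTop (𝓝 0)

/-- `f` is the limit in `H¹(B)`, together with its values on `N`, of `C¹` functions with compact
support in `K₁ ∩ {xₙ > 0}`, and `G` is the gradient of `f`. -/
structure HasH1TraceZero {m : ℕ} (f : Space m → ℝ) (G : Fin (m + 2) → Space m → ℝ) : Prop where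
  meas : AEStronglyMeasurable f (muBN m)
  meas_deriv : ∀ i, AEStronglyMeasurable (G i) (muB m)
  approx : ∀ ε : ℝ≥0∞, 0 < ε → ∃ φ : Space m → ℝ, ContDiff ℝ 1 φ ∧ HasCompactSupport φ ∧
    tsupport φ ⊆ cubeTop m ∧ eLpNorm (φ - f) 2 (muBN m) ≤ ε ∧
    ∀ i, eLpNorm (pderiv i φ - G i) 2 (muB m) ≤ ε

/-- Closure of the class under limits. It allows truncation in two stages: first u is approximated
by C¹ functions with ε fixed, then ε tends to 0. -/
lemma HasH1TraceZero.of_tendsto {m : ℕ} {f : Space m → ℝ} {G : Fin (m + 2) → Space m → ℝ}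
    {F : ℕ → Space m → ℝ} {H : ℕ → Fin (m + 2) → Space m → ℝ}
    (hf : AEStronglyMeasurable f (muBN m)) (hG : ∀ i, AEStronglyMeasurable (G i) (muB m))
    (hF : ∀ k, HasH1TraceZero (F k) (H k))
    (h1 : Tendsto (fun k => eLpNorm (F k - f) 2 (muBN m)) atTop (𝓝 0))
    (h2 : ∀ i, Tendsto (fun k => eLpNorm (H k i - G i) 2 (muB m)) atTop (𝓝 0)) :
    HasH1TraceZero f G := by
  refine ⟨hf, hG, fun ε hε => ?_⟩
  have hε2 : 0 < ε / 2 := ENNReal.div_pos hε.ne' (by norm_num)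
  obtain ⟨k, hk1, hk2⟩ := ((h1.eventually (ge_mem_nhds hε2)).and
    (eventually_all.2 fun i => (h2 i).eventually (ge_mem_nhds hε2))).exists
  obtain ⟨φ, c1, c2, c3, c4, c5⟩ := (hF k).approx _ hε2
  have hφd : Continuous (fderiv ℝ φ) := c1.continuous_fderiv one_ne_zero
  refine ⟨φ, c1, c2, c3, ?_, fun i => ?_⟩
  · calc eLpNorm (φ - f) 2 (muBN m) = eLpNorm ((φ - F k) + (F k - f)) 2 (muBN m) := by
          congr 1; abel
      _ ≤ _ := eLpNorm_add_le (c1.continuous.aestronglyMeasurable.sub (hF k).meas)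
          ((hF k).meas.sub hf) (by norm_num)
      _ ≤ ε / 2 + ε / 2 := add_le_add c4 hk1
      _ = ε := ENNReal.add_halves ε
  · calc eLpNorm (pderiv i φ - G i) 2 (muB m)
        = eLpNorm ((pderiv i φ - H k i) + (H k i - G i)) 2 (muB m) := by
          congr 1; abel
      _ ≤ _ := eLpNorm_add_le
          ((hφd.clm_apply continuous_const).aestronglyMeasurable.sub ((hF k).meas_deriv i))
          (((hF k).meas_deriv i).sub (hG i)) (by norm_num)
      _ ≤ ε / 2 + ε / 2 := add_le_add (c5 i) (hk2 i)
      _ = ε := ENNReal.add_halves ε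

lemma HasH1TraceZero.of_contDiff {m : ℕ} {φ : Space m → ℝ} (h1 : ContDiff ℝ 1 φ)
    (h2 : HasCompactSupport φ) (h3 : tsupport φ ⊆ cubeTop m) :
    HasH1TraceZero φ (fun i => pderiv i φ) := by
  refine ⟨h1.continuous.aestronglyMeasurable, fun i =>
    ((h1.continuous_fderiv one_ne_zero).clm_apply continuous_const).aestronglyMeasurable,
    fun ε _ => ⟨φ, h1, h2, h3, by simp, fun i => by simp⟩⟩

lemma IsTestFunction.continuous_pderiv {m : ℕ} {U : Set (Space m)} {ζ : Space m → ℝ}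
    (h : IsTestFunction U ζ) (i : Fin (m + 2)) : Continuous (pderiv i ζ) :=
  (h.smooth.continuous_fderiv (by simp)).clm_apply
    continuous_const

lemma IsTestFunction.exists_bound {m : ℕ} {U : Set (Space m)} {ζ : Space m → ℝ}
    (h : IsTestFunction U ζ) :
    ∃ M : ℝ, 0 ≤ M ∧ (∀ x, |ζ x| ≤ M) ∧ ∀ i x, |pderiv i ζ x| ≤ M := by
  obtain ⟨M₁, h1⟩ := h.compact.exists_bound_of_continuous h.smooth.continuous
  have h2 : ∀ i, ∃ M, ∀ x, ‖pderiv i ζ x‖ ≤ M := fun i =>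
    (h.compact.fderiv_apply ℝ (Pi.single i 1)).exists_bound_of_continuous (h.continuous_pderiv i)
  choose M₂ h2 using h2
  have hM₂ : ∀ i, 0 ≤ M₂ i := fun i => (norm_nonneg _).trans (h2 i 0)
  refine ⟨M₁ + ∑ i, M₂ i, add_nonneg ((norm_nonneg _).trans (h1 0))
    (Finset.sum_nonneg fun i _ => hM₂ i), fun x => ?_, fun i x => ?_⟩
  · exact (h1 x).trans (le_add_of_nonneg_right (Finset.sum_nonneg fun i _ => hM₂ i))
  · refine (h2 i x).trans ((Finset.single_le_sum (fun i _ => hM₂ i) (Finset.mem_univ i)).trans ?_)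
    exact le_add_of_nonneg_left ((norm_nonneg _).trans (h1 0))

lemma pderiv_softPos_comp_mul {m : ℕ} {ε : ℝ} (hε : 0 < ε) {φ ζ : Space m → ℝ}
    (hφ : ContDiff ℝ 1 φ) (hζ : ContDiff ℝ 1 ζ) (κ : ℝ) (i : Fin (m + 2)) (x : Space m) :
    pderiv i (fun x => softPos ε (φ x - κ) * ζ x) x =
      softPosDeriv ε (φ x - κ) * pderiv i φ x * ζ x + softPos ε (φ x - κ) * pderiv i ζ x := by
  have h1 : HasFDerivAt (fun x => softPos ε (φ x - κ)) (softPosDeriv ε (φ x - κ) • fderiv ℝ φ x) x :=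
    (hasDerivAt_softPos hε _).comp_hasFDerivAt x
      ((hφ.differentiable one_ne_zero x).hasFDerivAt.sub_const κ)
  have h2 := h1.mul (hζ.differentiable one_ne_zero x).hasFDerivAt
  have h3 : fderiv ℝ (fun x => softPos ε (φ x - κ) * ζ x) x = _ := h2.fderiv
  rw [pderiv, h3]
  simp [pderiv]
  ring

/-- For fixed ε the truncation is C¹ and 1-Lipschitz, so the chain rule holds for the approximants.
The error in the gradient splits into three terms: convergence of the gradients, of the factor
`softPosDeriv`, and of the functions themselves. -/
lemma HasH1Trace.softPos_mul {m : ℕ} {u : Space m → ℝ} {Du : Fin (m + 2) → Space m → ℝ}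
    (hu : HasH1Trace u Du) {ε : ℝ} (hε : 0 < ε) (κ : ℝ) {ζ : Space m → ℝ}
    (hζ : IsTestFunction (cubeTop m) ζ) :
    HasH1TraceZero (fun x => softPos ε (u x - κ) * ζ x)
      (fun i x => softPosDeriv ε (u x - κ) * Du i x * ζ x + softPos ε (u x - κ) * pderiv i ζ x) := by
  obtain ⟨φ₀, hφ₀, hl₀, hl₀'⟩ := hu.approx
  obtain ⟨M, hM, hM1, hM2⟩ := hζ.exists_bound
  have hζ1 : ContDiff ℝ 1 ζ := hζ.smooth.of_le (by simp)
  -- Convergence almost everywhere is needed for the middle term: it contains Du, which is merely in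
  -- L², so the factor in front is handled by dominated convergence.
  obtain ⟨ns, hns, hae⟩ := (tendstoInMeasure_of_tendsto_eLpNorm (two_ne_zero)
    (fun n => (hφ₀ n).continuous.aestronglyMeasurable) hu.memLp.1 hl₀).exists_seq_tendsto_ae
  obtain ⟨φ, hφdef⟩ : ∃ φ : ℕ → Space m → ℝ, φ = fun k => φ₀ (ns k) := ⟨_, rfl⟩
  have hφ : ∀ k, ContDiff ℝ 1 (φ k) := fun k => hφdef ▸ hφ₀ _
  have hl : Tendsto (fun k => eLpNorm (φ k - u) 2 (muBN m)) atTop (𝓝 0) := by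
    rw [hφdef]; exact hl₀.comp hns.tendsto_atTop
  have hl' : ∀ i, Tendsto (fun k => eLpNorm (pderiv i (φ k) - Du i) 2 (muB m)) atTop (𝓝 0) := by
    rw [hφdef]; exact fun i => (hl₀' i).comp hns.tendsto_atTop
  have hae : ∀ᵐ x ∂(muB m), Tendsto (fun k => φ k x) atTop (𝓝 (u x)) := by
    rw [muBN, ae_add_measure_iff] at hae
    rw [hφdef]; exact hae.1
  have hcs : Continuous (softPos ε) := (contDiff_softPos hε).continuous
  have hcd := continuous_softPosDeriv hε
  have huB : AEStronglyMeasurable u (muB m) := hu.memLp.1.mono_measure (Measure.le_add_right le_rfl)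
  have hBle : ∀ f : Space m → ℝ, eLpNorm f 2 (muB m) ≤ eLpNorm f 2 (muBN m) := fun f =>
    eLpNorm_mono_measure _ (Measure.le_add_right le_rfl)
  refine HasH1TraceZero.of_tendsto (F := fun k x => softPos ε (φ k x - κ) * ζ x)
    (H := fun k i => pderiv i (fun x => softPos ε (φ k x - κ) * ζ x)) ?_ ?_ ?_ ?_ ?_
  · exact (hcs.comp_aestronglyMeasurable (hu.memLp.1.sub aestronglyMeasurable_const)).mul
      hζ1.continuous.aestronglyMeasurable
  · intro i
    have h := huB.sub (aestronglyMeasurable_const (b := κ))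
    exact (((hcd.comp_aestronglyMeasurable h).mul (hu.memLp_deriv i).1).mul
      hζ1.continuous.aestronglyMeasurable).add
      ((hcs.comp_aestronglyMeasurable h).mul (hζ.continuous_pderiv i).aestronglyMeasurable)
  · intro k
    refine HasH1TraceZero.of_contDiff ?_ hζ.compact.mul_left ?_
    · exact ((contDiff_softPos hε).comp ((hφ k).sub contDiff_const)).mul hζ1
    · exact (tsupport_mul_subset_right).trans hζ.support_subset
  · have h0 : Tendsto (fun k => ENNReal.ofReal M * eLpNorm (φ k - u) 2 (muBN m)) atTop (𝓝 0) := by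
      have := ENNReal.Tendsto.const_mul hl (Or.inr (ENNReal.ofReal_ne_top (r := M)))
      rwa [mul_zero] at this
    refine tendsto_of_tendsto_of_tendsto_of_le_of_le tendsto_const_nhds h0 (fun _ => zero_le)
      fun k => ?_
    refine eLpNorm_le_mul_eLpNorm_of_ae_le_mul (ae_of_all _ fun x => ?_) 2
    simp only [Pi.sub_apply, Real.norm_eq_abs]
    rw [← sub_mul, abs_mul, mul_comm]
    refine mul_le_mul (hM1 x) ?_ (abs_nonneg _) hM
    refine (abs_softPos_sub_softPos_le hε _ _).trans (le_of_eq ?_)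
    congr 1; ring
  · intro i
    have hmid : Tendsto (fun k => eLpNorm
        (fun x => (softPosDeriv ε (φ k x - κ) - softPosDeriv ε (u x - κ)) * Du i x) 2 (muB m))
        atTop (𝓝 0) := by
      refine tendsto_eLpNorm_two_of_dominated (g := fun x => 2 * Du i x) (fun k => ?_)
        ((hu.memLp_deriv i).const_mul 2) (fun k => ae_of_all _ fun x => ?_) ?_
      · exact ((hcd.comp_aestronglyMeasurable
          ((hφ k).continuous.aestronglyMeasurable.sub aestronglyMeasurable_const)).sub
          (hcd.comp_aestronglyMeasurable (huB.sub aestronglyMeasurable_const))).mul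
          (hu.memLp_deriv i).1
      · rw [abs_mul, abs_mul]
        refine mul_le_mul_of_nonneg_right ?_ (abs_nonneg _)
        refine (abs_sub _ _).trans ?_
        have h1 := softPosDeriv_mem hε (φ k x - κ)
        have h2 := softPosDeriv_mem hε (u x - κ)
        rw [abs_two]; linarith
      · filter_upwards [hae] with x hx
        have h1 := (hcd.tendsto (u x - κ)).comp (hx.sub_const κ)
        have h2 := (h1.sub_const (softPosDeriv ε (u x - κ))).mul_const (Du i x)
        simpa using h2
    have h0 : Tendsto (fun k => ENNReal.ofReal M * eLpNorm (pderiv i (φ k) - Du i) 2 (muB m)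
        + ENNReal.ofReal M * eLpNorm
        (fun x => (softPosDeriv ε (φ k x - κ) - softPosDeriv ε (u x - κ)) * Du i x) 2 (muB m)
        + ENNReal.ofReal M * eLpNorm (φ k - u) 2 (muBN m)) atTop (𝓝 0) := by
      have h1 := ENNReal.Tendsto.const_mul (hl' i) (Or.inr (ENNReal.ofReal_ne_top (r := M)))
      have h2 := ENNReal.Tendsto.const_mul hmid (Or.inr (ENNReal.ofReal_ne_top (r := M)))
      have h3 := ENNReal.Tendsto.const_mul hl (Or.inr (ENNReal.ofReal_ne_top (r := M)))
      simpa using (h1.add h2).add h3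
    refine tendsto_of_tendsto_of_tendsto_of_le_of_le tendsto_const_nhds h0 (fun _ => zero_le)
      fun k => ?_
    have hdφ : AEStronglyMeasurable (pderiv i (φ k)) (muB m) :=
      (((hφ k).continuous_fderiv one_ne_zero).clm_apply continuous_const).aestronglyMeasurable
    have mφ : AEStronglyMeasurable (φ k) (muB m) := (hφ k).continuous.aestronglyMeasurable
    have mζ : AEStronglyMeasurable ζ (muB m) := hζ1.continuous.aestronglyMeasurable
    have mh := hcd.comp_aestronglyMeasurable (mφ.sub (aestronglyMeasurable_const (b := κ)))
    have mh' := hcd.comp_aestronglyMeasurable (huB.sub (aestronglyMeasurable_const (b := κ)))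
    have ms := hcs.comp_aestronglyMeasurable (mφ.sub (aestronglyMeasurable_const (b := κ)))
    have ms' := hcs.comp_aestronglyMeasurable (huB.sub (aestronglyMeasurable_const (b := κ)))
    obtain ⟨A₁, hA₁⟩ : ∃ A : Space m → ℝ, A = fun x =>
      softPosDeriv ε (φ k x - κ) * (pderiv i (φ k) x - Du i x) * ζ x := ⟨_, rfl⟩
    obtain ⟨A₂, hA₂⟩ : ∃ A : Space m → ℝ, A = fun x =>
      (softPosDeriv ε (φ k x - κ) - softPosDeriv ε (u x - κ)) * Du i x * ζ x := ⟨_, rfl⟩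
    obtain ⟨A₃, hA₃⟩ : ∃ A : Space m → ℝ, A = fun x =>
      (softPos ε (φ k x - κ) - softPos ε (u x - κ)) * pderiv i ζ x := ⟨_, rfl⟩
    have m₁ : AEStronglyMeasurable A₁ (muB m) := by
      rw [hA₁]; exact (mh.mul (hdφ.sub (hu.memLp_deriv i).1)).mul mζ
    have m₂ : AEStronglyMeasurable A₂ (muB m) := by
      rw [hA₂]; exact ((mh.sub mh').mul (hu.memLp_deriv i).1).mul mζ
    have m₃ : AEStronglyMeasurable A₃ (muB m) := by
      rw [hA₃]; exact (ms.sub ms').mul (hζ.continuous_pderiv i).aestronglyMeasurable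
    have e : (pderiv i (fun x => softPos ε (φ k x - κ) * ζ x) - fun x =>
        softPosDeriv ε (u x - κ) * Du i x * ζ x + softPos ε (u x - κ) * pderiv i ζ x)
        = A₁ + A₂ + A₃ := by
      funext x
      simp only [Pi.sub_apply, Pi.add_apply, pderiv_softPos_comp_mul hε (hφ k) hζ1, hA₁, hA₂, hA₃]
      ring
    rw [e]
    refine (eLpNorm_add_le (m₁.add m₂) m₃ (by norm_num)).trans (add_le_add
      ((eLpNorm_add_le m₁ m₂ (by norm_num)).trans (add_le_add ?_ ?_)) ?_)
    · refine eLpNorm_le_mul_eLpNorm_of_ae_le_mul (ae_of_all _ fun x => ?_) 2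
      simp only [hA₁, Pi.sub_apply, Real.norm_eq_abs, abs_mul]
      calc _ ≤ 1 * |pderiv i (φ k) x - Du i x| * M :=
            mul_le_mul (mul_le_mul_of_nonneg_right (softPosDeriv_mem hε _) (abs_nonneg _))
              (hM1 x) (abs_nonneg _) (by positivity)
        _ = _ := by ring
    · refine eLpNorm_le_mul_eLpNorm_of_ae_le_mul (ae_of_all _ fun x => ?_) 2
      simp only [hA₂, Real.norm_eq_abs]
      rw [abs_mul, mul_comm]
      exact mul_le_mul_of_nonneg_right (hM1 x) (abs_nonneg _)
    · refine (eLpNorm_le_mul_eLpNorm_of_ae_le_mul (ae_of_all _ fun x => ?_) 2).trans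
        (mul_le_mul_right (hBle _) _)
      simp only [hA₃, Pi.sub_apply, Real.norm_eq_abs]
      rw [abs_mul, mul_comm]
      refine mul_le_mul (hM2 i x) ?_ (abs_nonneg _) hM
      refine (abs_softPos_sub_softPos_le hε _ _).trans (le_of_eq ?_)
      congr 1; ring

/-- The gradient of `(u - κ)⁺ ζ`. -/
def truncGrad {m : ℕ} (u : Space m → ℝ) (Du : Fin (m + 2) → Space m → ℝ) (κ : ℝ)
    (ζ : Space m → ℝ) (i : Fin (m + 2)) (x : Space m) : ℝ :=
  (if 0 < u x - κ then 1 else 0) * Du i x * ζ x + max (u x - κ) 0 * pderiv i ζ x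

/-- The limit ε → 0: since 0 ≤ `softPos ε t` ≤ t⁺ and |`softPosDeriv`| ≤ 1, dominated convergence
applies to the function and to its gradient. -/
lemma HasH1Trace.truncate_mul {m : ℕ} {u : Space m → ℝ} {Du : Fin (m + 2) → Space m → ℝ}
    (hu : HasH1Trace u Du) (κ : ℝ) {ζ : Space m → ℝ} (hζ : IsTestFunction (cubeTop m) ζ) :
    HasH1TraceZero (fun x => max (u x - κ) 0 * ζ x) (truncGrad u Du κ ζ) := by
  obtain ⟨M, hM, hM1, hM2⟩ := hζ.exists_bound
  have hζ1 : ContDiff ℝ 1 ζ := hζ.smooth.of_le (by simp)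
  have huB : AEStronglyMeasurable u (muB m) := hu.memLp.1.mono_measure (Measure.le_add_right le_rfl)
  obtain ⟨e, he, he0⟩ : ∃ e : ℕ → ℝ, (∀ k, 0 < e k) ∧ Tendsto e atTop (𝓝 0) :=
    ⟨fun k => 1 / ((k : ℝ) + 1), fun k => by positivity, tendsto_one_div_add_atTop_nhds_zero_nat⟩
  have hcm : Continuous fun t : ℝ => max t 0 := by fun_prop
  have hstep : StronglyMeasurable fun t : ℝ => if 0 < t then (1 : ℝ) else 0 :=
    (Measurable.ite measurableSet_Ioi measurable_const measurable_const).stronglyMeasurable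
  have hfun : AEStronglyMeasurable (fun x => u x - κ) (muB m) :=
    huB.sub aestronglyMeasurable_const
  have hstepu : AEStronglyMeasurable (fun x => if 0 < u x - κ then (1 : ℝ) else 0) (muB m) := by
    have := hstep.measurable.comp_aemeasurable hfun.aemeasurable
    exact this.aestronglyMeasurable
  have hmax : AEStronglyMeasurable (fun x => max (u x - κ) 0) (muB m) :=
    hcm.comp_aestronglyMeasurable hfun
  have hbd : ∀ k x, |softPos (e k) (u x - κ) - max (u x - κ) 0| ≤ |u x - κ| := by
    intro k x
    have h0 := le_max_right (u x - κ) 0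
    have h2 : softPos (e k) (u x - κ) ≤ max (u x - κ) 0 := by
      have := he k
      have : e k ^ 2 / (max (u x - κ) 0 + e k) ≤ e k := by
        rw [div_le_iff₀ (by linarith)]; nlinarith
      rw [softPos]; linarith
    have h3 : 0 ≤ softPos (e k) (u x - κ) := by
      have := he k
      have : softPos (e k) (u x - κ) = max (u x - κ) 0 ^ 2 / (max (u x - κ) 0 + e k) := by
        rw [softPos]; field_simp; ring
      rw [this]; positivity
    rw [abs_of_nonpos (by linarith)]
    have := max_le (le_abs_self (u x - κ)) (abs_nonneg _)
    linarith
  have hmemN : MemLp (fun x => u x - κ) 2 (muBN m) := hu.memLp.sub (memLp_const κ)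
  have hmemB : MemLp (fun x => u x - κ) 2 (muB m) :=
    hmemN.mono_measure (Measure.le_add_right le_rfl)
  have hlim : ∀ x, Tendsto (fun k => softPos (e k) (u x - κ) - max (u x - κ) 0) atTop (𝓝 0) :=
    fun x => squeeze_zero_norm (fun k => abs_softPos_sub_le (he k) _) he0
  refine HasH1TraceZero.of_tendsto ?_ ?_ (fun k => hu.softPos_mul (he k) κ hζ) ?_ ?_
  · exact (hcm.comp_aestronglyMeasurable (hu.memLp.1.sub aestronglyMeasurable_const)).mul
      hζ1.continuous.aestronglyMeasurable
  · intro i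
    exact ((hstepu.mul (hu.memLp_deriv i).1).mul hζ1.continuous.aestronglyMeasurable).add
      (hmax.mul (hζ.continuous_pderiv i).aestronglyMeasurable)
  · refine tendsto_eLpNorm_two_of_dominated (g := fun x => M * (u x - κ)) (fun k => ?_)
      (hmemN.const_mul M) (fun k => ae_of_all _ fun x => ?_) (ae_of_all _ fun x => ?_)
    · exact (((contDiff_softPos (he k)).continuous.comp_aestronglyMeasurable hmemN.1).mul
        hζ1.continuous.aestronglyMeasurable).sub
        ((hcm.comp_aestronglyMeasurable hmemN.1).mul hζ1.continuous.aestronglyMeasurable)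
    · simp only [Pi.sub_apply]
      rw [← sub_mul, abs_mul, abs_mul, mul_comm, abs_of_nonneg hM]
      exact mul_le_mul (hM1 x) (hbd k x) (abs_nonneg _) hM
    · simpa [sub_mul] using (hlim x).mul_const (ζ x)
  · intro i
    refine tendsto_eLpNorm_two_of_dominated
      (g := fun x => 2 * M * |Du i x| + M * |u x - κ|) (fun k => ?_)
      (((hu.memLp_deriv i).abs.const_mul (2 * M)).add (hmemB.abs.const_mul M))
      (fun k => ae_of_all _ fun x => ?_) (ae_of_all _ fun x => ?_)
    · exact ((((continuous_softPosDeriv (he k)).comp_aestronglyMeasurable hfun).mul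
        (hu.memLp_deriv i).1).mul hζ1.continuous.aestronglyMeasurable).add
        (((contDiff_softPos (he k)).continuous.comp_aestronglyMeasurable hfun).mul
        (hζ.continuous_pderiv i).aestronglyMeasurable) |>.sub
        (((hstepu.mul (hu.memLp_deriv i).1).mul hζ1.continuous.aestronglyMeasurable).add
          (hmax.mul (hζ.continuous_pderiv i).aestronglyMeasurable))
    · simp only [Pi.sub_apply, truncGrad]
      have e1 : softPosDeriv (e k) (u x - κ) * Du i x * ζ x + softPos (e k) (u x - κ) * pderiv i ζ x
          - ((if 0 < u x - κ then 1 else 0) * Du i x * ζ x + max (u x - κ) 0 * pderiv i ζ x)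
          = (softPosDeriv (e k) (u x - κ) - (if 0 < u x - κ then 1 else 0)) * Du i x * ζ x
            + (softPos (e k) (u x - κ) - max (u x - κ) 0) * pderiv i ζ x := by ring
      rw [e1, abs_of_nonneg (a := 2 * M * |Du i x| + M * |u x - κ|) (by positivity)]
      refine (abs_add_le _ _).trans (add_le_add ?_ ?_)
      · rw [abs_mul, abs_mul]
        have h1 : |softPosDeriv (e k) (u x - κ) - (if 0 < u x - κ then 1 else 0)| ≤ 2 := by
          refine (abs_sub _ _).trans ?_
          have := softPosDeriv_mem (he k) (u x - κ)
          split_ifs <;> simp <;> linarith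
        calc _ ≤ 2 * |Du i x| * M := mul_le_mul (mul_le_mul_of_nonneg_right h1 (abs_nonneg _))
              (hM1 x) (abs_nonneg _) (by positivity)
          _ = _ := by ring
      · rw [abs_mul, mul_comm]
        exact mul_le_mul (hM2 i x) (hbd k x) (abs_nonneg _) hM
    · have h1 := tendsto_softPosDeriv (u x - κ) he he0
      have h2 := ((h1.mul_const (Du i x)).mul_const (ζ x)).add
        (((hlim x).add_const (max (u x - κ) 0)).mul_const (pderiv i ζ x))
      have h3 := h2.sub_const (truncGrad u Du κ ζ i x)
      simpa [truncGrad] using h3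

/-! ### The Sobolev inequality for limits, and identification of weak derivatives. -/

lemma HasH1TraceZero.memLp {m : ℕ} {f : Space m → ℝ} {G : Fin (m + 2) → Space m → ℝ}
    (h : HasH1TraceZero f G) : MemLp f 2 (muBN m) := by
  obtain ⟨φ, c1, c2, -, c4, -⟩ := h.approx 1 one_pos
  have h1 : MemLp φ 2 (muBN m) := c1.continuous.memLp_of_hasCompactSupport c2
  have h2 : MemLp (φ - f) 2 (muBN m) :=
    ⟨c1.continuous.aestronglyMeasurable.sub h.meas, c4.trans_lt ENNReal.one_lt_top⟩
  simpa using h1.sub h2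

lemma HasH1TraceZero.memLp_deriv {m : ℕ} {f : Space m → ℝ} {G : Fin (m + 2) → Space m → ℝ}
    (h : HasH1TraceZero f G) (i : Fin (m + 2)) : MemLp (G i) 2 (muB m) := by
  obtain ⟨φ, c1, c2, -, -, c5⟩ := h.approx 1 one_pos
  have hc : Continuous (pderiv i φ) :=
    (c1.continuous_fderiv one_ne_zero).clm_apply continuous_const
  have h1 : MemLp (pderiv i φ) 2 (muB m) := hc.memLp_of_hasCompactSupport (c2.fderiv_apply ℝ _)
  have h2 : MemLp (pderiv i φ - G i) 2 (muB m) :=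
    ⟨hc.aestronglyMeasurable.sub (h.meas_deriv i), (c5 i).trans_lt ENNReal.one_lt_top⟩
  simpa using h1.sub h2

/-- The Sobolev and trace inequalities. -/
lemma exists_sobolev_const {m : ℕ} (hm : 1 ≤ m) :
    ∃ C : ℝ≥0∞, C ≠ ⊤ ∧ ∀ (f : Space m → ℝ) (G : Fin (m + 2) → Space m → ℝ),
      HasH1TraceZero f G →
      eLpNorm f (ENNReal.ofReal (traceExp m)) (muBN m) ≤ C * ∑ i, eLpNorm (G i) 2 (muB m) := by
  obtain ⟨C, hC, hS⟩ := exists_eLpNorm_muBN_le hm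
  refine ⟨C, hC, fun f G h => ?_⟩
  obtain ⟨e, he, he0⟩ : ∃ e : ℕ → ℝ≥0∞, (∀ k, 0 < e k) ∧ Tendsto e atTop (𝓝 0) :=
    -- At k = 0 the value is ⊤, which is a harmless accuracy.
    ⟨fun k => ((k : ℝ≥0∞) )⁻¹, fun k => by simp, ENNReal.tendsto_inv_nat_nhds_zero⟩
  choose φ c1 c2 c3 c4 c5 using fun k => h.approx (e k) (he k)
  have hl : Tendsto (fun k => eLpNorm (φ k - f) 2 (muBN m)) atTop (𝓝 0) :=
    tendsto_of_tendsto_of_tendsto_of_le_of_le tendsto_const_nhds he0 (fun _ => zero_le) c4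
  obtain ⟨ns, hns, hae⟩ := (tendstoInMeasure_of_tendsto_eLpNorm (two_ne_zero)
    (fun n => (c1 n).continuous.aestronglyMeasurable) h.meas hl).exists_seq_tendsto_ae
  -- Fatou's lemma: the approximants converge only in L², but an almost everywhere convergent
  -- subsequence carries the L^r bound to the limit.
  have h1 := Lp.eLpNorm_lim_le_liminf_eLpNorm (p := ENNReal.ofReal (traceExp m))
    (fun n => (c1 (ns n)).continuous.aestronglyMeasurable) f hae
  have hb : ∀ n, eLpNorm (φ (ns n)) (ENNReal.ofReal (traceExp m)) (muBN m)
      ≤ C * ∑ i, (eLpNorm (G i) 2 (muB m) + e (ns n)) := by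
    intro n
    refine (hS _ (c1 _) (c2 _) (c3 _)).trans ?_
    gcongr with i
    have hd : AEStronglyMeasurable (pderiv i (φ (ns n))) (muB m) :=
      (((c1 (ns n)).continuous_fderiv one_ne_zero).clm_apply continuous_const).aestronglyMeasurable
    calc eLpNorm (pderiv i (φ (ns n))) 2 (muB m)
        = eLpNorm (G i + (pderiv i (φ (ns n)) - G i)) 2 (muB m) := by
          congr 1; abel
      _ ≤ _ := eLpNorm_add_le (h.meas_deriv i) (hd.sub (h.meas_deriv i)) (by norm_num)
      _ ≤ _ := by gcongr; exact c5 _ _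
  have hlim : Tendsto (fun n => C * ∑ i, (eLpNorm (G i) 2 (muB m) + e (ns n))) atTop
      (𝓝 (C * ∑ i, (eLpNorm (G i) 2 (muB m) + 0))) := by
    refine ENNReal.Tendsto.const_mul ?_ (Or.inr hC)
    exact tendsto_finsetSum _ fun i _ => tendsto_const_nhds.add (he0.comp hns.tendsto_atTop)
  refine h1.trans ?_
  calc _ ≤ atTop.liminf fun n => C * ∑ i, (eLpNorm (G i) 2 (muB m) + e (ns n)) :=
        liminf_le_liminf (Eventually.of_forall hb)
    _ = _ := by rw [hlim.liminf_eq]; simp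

lemma enorm_integral_mul_le {α : Type*} [MeasurableSpace α] {ν : Measure α}
    {F ψ : α → ℝ} {M : ℝ} (hF : AEStronglyMeasurable F ν)
    (hM : ∀ x, |ψ x| ≤ M) :
    ‖∫ x, F x * ψ x ∂ν‖ₑ ≤ ENNReal.ofReal M * (eLpNorm F 2 ν * ν univ ^ (1 / 2 : ℝ)) := by
  calc ‖∫ x, F x * ψ x ∂ν‖ₑ ≤ ∫⁻ x, ‖F x * ψ x‖ₑ ∂ν := enorm_integral_le_lintegral_enorm _
    _ = eLpNorm (fun x => F x * ψ x) 1 ν := by rw [eLpNorm_one_eq_lintegral_enorm]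
    _ ≤ ENNReal.ofReal M * eLpNorm F 1 ν := by
        refine eLpNorm_le_mul_eLpNorm_of_ae_le_mul (ae_of_all _ fun x => ?_) 1
        rw [Real.norm_eq_abs, abs_mul, mul_comm]
        exact mul_le_mul_of_nonneg_right (hM x) (abs_nonneg _)
    _ ≤ _ := by
        gcongr
        refine (eLpNorm_le_eLpNorm_mul_rpow_measure_univ (p := 1) (q := 2) (by norm_num) hF).trans
          (le_of_eq ?_)
        congr 2
        norm_num

/-- Integration by parts is stable under L² convergence of the function and its gradient; the defect
in the identity for f is at most a constant times the accuracy of the approximant. -/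
lemma HasH1TraceZero.isWeakDeriv {m : ℕ} {f : Space m → ℝ} {G : Fin (m + 2) → Space m → ℝ}
    (h : HasH1TraceZero f G) (i : Fin (m + 2)) : IsWeakDeriv (domB m) i f (G i) := by
  have hle : muB m ≤ muBN m := Measure.le_add_right le_rfl
  have hfB : MemLp f 2 (muB m) := h.memLp.mono_measure hle
  have hGB := h.memLp_deriv i
  refine ⟨IntegrableOn.locallyIntegrableOn (hfB.integrable (by norm_num)),
    IntegrableOn.locallyIntegrableOn (hGB.integrable (by norm_num)), fun ψ hψ => ?_⟩
  obtain ⟨M, hM, hM1, hM2⟩ := hψ.exists_bound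
  change ∫ x, f x * pderiv i ψ x ∂(muB m) = - ∫ x, G i x * ψ x ∂(muB m)
  have hcψ := hψ.smooth.continuous
  have hcψ' := hψ.continuous_pderiv i
  have intmul : ∀ {F θ : Space m → ℝ}, MemLp F 2 (muB m) → Continuous θ → (∀ x, |θ x| ≤ M) →
      Integrable (fun x => F x * θ x) (muB m) := fun hF hθ hb =>
    (hF.integrable (by norm_num)).mul_bdd (c := M) hθ.aestronglyMeasurable (ae_of_all _ hb)
  obtain ⟨K, hKdef⟩ : ∃ K : ℝ≥0∞, K = ENNReal.ofReal M * muB m univ ^ (1 / 2 : ℝ) +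
    ENNReal.ofReal M * muB m univ ^ (1 / 2 : ℝ) := ⟨_, rfl⟩
  have hK : K ≠ ⊤ := by
    have : ENNReal.ofReal M * muB m univ ^ (1 / 2 : ℝ) ≠ ⊤ :=
      ENNReal.mul_ne_top ENNReal.ofReal_ne_top
        (ENNReal.rpow_ne_top_of_nonneg (by norm_num) (measure_ne_top _ _))
    rw [hKdef]; exact ENNReal.add_ne_top.2 ⟨this, this⟩
  have key : ∀ ε : ℝ≥0∞, 0 < ε →
      ‖(∫ x, f x * pderiv i ψ x ∂(muB m)) + ∫ x, G i x * ψ x ∂(muB m)‖ₑ ≤ K * ε := by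
    intro ε hε
    obtain ⟨φ, c1, c2, -, c4, c5⟩ := h.approx ε hε
    have hd : Continuous (pderiv i φ) :=
      (c1.continuous_fderiv one_ne_zero).clm_apply continuous_const
    have hφ2 : MemLp φ 2 (muB m) := c1.continuous.memLp_of_hasCompactSupport c2
    have hφ2' : MemLp (pderiv i φ) 2 (muB m) := hd.memLp_of_hasCompactSupport (c2.fderiv_apply ℝ _)
    have hparts : ∫ x, φ x * pderiv i ψ x ∂(muB m) = - ∫ x, pderiv i φ x * ψ x ∂(muB m) := by
      -- The test function vanishes outside B, so the integrals extend to the whole space and no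
      -- boundary term on N appears, although the approximant need not vanish there.
      have out : ∀ x, x ∉ domB m → ψ x = 0 ∧ pderiv i ψ x = 0 := by
        intro x hx
        have hx' : x ∉ tsupport ψ := fun hx' => hx (hψ.support_subset hx')
        refine ⟨image_eq_zero_of_notMem_tsupport hx', ?_⟩
        have : fderiv ℝ ψ x = 0 := by
          by_contra h0
          exact hx' (support_fderiv_subset ℝ h0)
        rw [pderiv, this]; rfl
      rw [muB, setIntegral_eq_integral_of_forall_compl_eq_zero fun x hx => by simp [(out x hx).2],
        setIntegral_eq_integral_of_forall_compl_eq_zero fun x hx => by simp [(out x hx).1]]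
      refine integral_mul_fderiv_eq_neg_fderiv_mul_of_integrable ?_ ?_ ?_
        (fun x _ => c1.differentiable one_ne_zero x)
        (fun x _ => hψ.smooth.differentiable (by simp) x)
      · exact (hd.mul hcψ).integrable_of_hasCompactSupport hψ.compact.mul_left
      · exact (c1.continuous.mul hcψ').integrable_of_hasCompactSupport c2.mul_right
      · exact (c1.continuous.mul hcψ).integrable_of_hasCompactSupport c2.mul_right
    have e1 : (∫ x, f x * pderiv i ψ x ∂(muB m)) + ∫ x, G i x * ψ x ∂(muB m)
        = -(∫ x, (φ - f) x * pderiv i ψ x ∂(muB m))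
          - ∫ x, (pderiv i φ - G i) x * ψ x ∂(muB m) := by
      simp only [Pi.sub_apply, sub_mul]
      rw [integral_sub (intmul hφ2 hcψ' (hM2 i)) (intmul hfB hcψ' (hM2 i)),
        integral_sub (intmul hφ2' hcψ hM1) (intmul hGB hcψ hM1), hparts]
      ring
    rw [e1, sub_eq_add_neg]
    refine (enorm_add_le _ _).trans ?_
    rw [enorm_neg, enorm_neg, hKdef, add_mul]
    refine add_le_add ?_ ?_
    · refine (enorm_integral_mul_le (hφ2.1.sub hfB.1) (hM2 i)).trans ?_
      rw [mul_assoc, mul_comm (muB m univ ^ _)]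
      gcongr
      exact (eLpNorm_mono_measure _ hle).trans c4
    · refine (enorm_integral_mul_le (hφ2'.1.sub hGB.1) hM1).trans ?_
      rw [mul_assoc, mul_comm (muB m univ ^ _)]
      gcongr
      exact c5 i
  have hz : ‖(∫ x, f x * pderiv i ψ x ∂(muB m)) + ∫ x, G i x * ψ x ∂(muB m)‖ₑ ≤ 0 := by
    obtain ⟨e, he, he0⟩ : ∃ e : ℕ → ℝ≥0∞, (∀ k, 0 < e k) ∧ Tendsto e atTop (𝓝 0) :=
      ⟨fun k => ((k : ℝ≥0∞))⁻¹, fun k => by simp, ENNReal.tendsto_inv_nat_nhds_zero⟩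
    have := ENNReal.Tendsto.const_mul he0 (Or.inr hK)
    rw [mul_zero] at this
    exact ge_of_tendsto' this fun k => key _ (he k)
  have := enorm_eq_zero.1 (le_antisymm hz zero_le)
  linarith

lemma IsWeakDeriv.ae_eq {m : ℕ} {U : Set (Space m)} (hU : IsOpen U) {i : Fin (m + 2)}
    {u w w' : Space m → ℝ} (h : IsWeakDeriv U i u w) (h' : IsWeakDeriv U i u w') :
    w =ᵐ[volume.restrict U] w' := by
  have h0 := hU.ae_eq_zero_of_integral_contDiff_smul_eq_zero (μ := volume) (f := w - w')
    (h.locInt_deriv.sub h'.locInt_deriv) ?_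
  · rw [Filter.EventuallyEq, ae_restrict_iff' hU.measurableSet]
    filter_upwards [h0] with x hx hxU
    exact sub_eq_zero.1 (hx hxU)
  intro g hg hgc hgs
  have hout : ∀ x, x ∉ U → g x • (w - w') x = 0 := by
    intro x hx
    have hx' : x ∉ tsupport g := fun hx' => hx (hgs hx')
    simp [image_eq_zero_of_notMem_tsupport hx']
  rw [← setIntegral_eq_integral_of_forall_compl_eq_zero hout]
  have hint : ∀ {v : Space m → ℝ}, LocallyIntegrableOn v U volume →
      IntegrableOn (fun x => v x * g x) U volume := by
    intro v hv
    have h1 : IntegrableOn (fun x => g x • v x) (tsupport g) volume :=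
      (hv.integrableOn_compact_subset hgs hgc).continuousOn_smul hg.continuous.continuousOn hgc
    have h2 : IntegrableOn (fun x => v x * g x) (tsupport g) volume := by
      refine h1.congr (ae_of_all _ fun x => ?_)
      simp [mul_comm]
    have h3 : Integrable (fun x => v x * g x) volume := by
      refine (integrableOn_iff_integrable_of_support_subset fun x hx => ?_).1 h2
      exact subset_tsupport g (right_ne_zero_of_mul hx)
    exact h3.integrableOn
  have e1 := h.integral_eq g ⟨hg, hgc, hgs⟩
  have e2 := h'.integral_eq g ⟨hg, hgc, hgs⟩
  calc ∫ x in U, g x • (w - w') x = ∫ x in U, (w x * g x - w' x * g x) := by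
        refine integral_congr_ae (ae_of_all _ fun x => ?_)
        simp; ring
    _ = (∫ x in U, w x * g x) - ∫ x in U, w' x * g x :=
        integral_sub (hint h.locInt_deriv) (hint h'.locInt_deriv)
    _ = 0 := by linarith

/-- `weakDeriv` is an arbitrary choice; this lets an explicit gradient replace it under integrals.
-/
lemma IsWeakDeriv.weakDeriv_ae_eq {m : ℕ} {U : Set (Space m)} (hU : IsOpen U) {i : Fin (m + 2)}
    {u w : Space m → ℝ} (h : IsWeakDeriv U i u w) :
    weakDeriv U i u =ᵐ[volume.restrict U] w := by
  have hex : ∃ w, IsWeakDeriv U i u w := ⟨w, h⟩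
  rw [weakDeriv, dif_pos hex]
  exact hex.choose_spec.ae_eq hU h

/-- The approximants defining the trace converge on B and on N simultaneously, hence in L² of the
sum measure. -/
lemma HasH1Trace.of_memH1 {m : ℕ} {u : Space m → ℝ} (hu : MemH1 (domB m) u)
    (ht : IsTraceOnN u u) : HasH1Trace u (fun i => weakDeriv (domB m) i u) := by
  obtain ⟨hT, φ, h1, h2, h3, h4⟩ := ht
  have hmeas : AEStronglyMeasurable u (muBN m) := hu.1.1.add_measure hT.1
  refine ⟨⟨hmeas, ?_⟩, fun i => ?_, φ, fun k => (h1 k).of_le (by simp), ?_, h3⟩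
  · exact (eLpNorm_two_add_measure_le _ _ _).trans_lt (ENNReal.add_lt_top.2 ⟨hu.1.2, hT.2⟩)
  · obtain ⟨w, hw, hw2⟩ := hu.2 i
    exact hw2.ae_eq (hw.weakDeriv_ae_eq (isOpen_domB m)).symm
  · have := h2.add h4
    rw [add_zero] at this
    exact tendsto_of_tendsto_of_tendsto_of_le_of_le tendsto_const_nhds this (fun _ => zero_le)
      fun k => eLpNorm_two_add_measure_le _ _ _

/-! ### The Caccioppoli inequality. -/

lemma IsTestFunction.sq {m : ℕ} {U : Set (Space m)} {ζ : Space m → ℝ} (h : IsTestFunction U ζ) :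
    IsTestFunction U (fun x => ζ x ^ 2) := by
  have e : (fun x => ζ x ^ 2) = ζ * ζ := by funext x; simp [_root_.sq]
  rw [e]
  exact ⟨h.smooth.mul h.smooth, h.compact.mul_left, tsupport_mul_subset_left.trans h.support_subset⟩

lemma IsTestFunction.pderiv_sq {m : ℕ} {U : Set (Space m)} {ζ : Space m → ℝ}
    (h : IsTestFunction U ζ) (i : Fin (m + 2)) (x : Space m) :
    pderiv i (fun x => ζ x ^ 2) x = 2 * ζ x * pderiv i ζ x := by
  have h1 := ((h.smooth.differentiable (by simp)) x).hasFDerivAt.pow 2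
  rw [pderiv, h1.fderiv]
  simp [pderiv]

/-- The algebraic core of the Caccioppoli inequality. -/
lemma sum_sq_le_of_elliptic {n : ℕ} {lam Lam χ w z : ℝ} {a : Fin n → Fin n → ℝ}
    {d e : Fin n → ℝ} (hlam : 0 < lam) (hχ : χ ^ 2 = χ) (hw : w * χ = w)
    (ha : ∀ i j, |a i j| ≤ Lam)
    (hell : ∀ y : Fin n → ℝ, lam * ∑ i, y i ^ 2 ≤ ∑ i, ∑ j, a i j * y i * y j) :
    ∑ i, (χ * d i * z + w * e i) ^ 2 ≤
      4 / lam * (∑ i, ∑ j, a i j * d i * (χ * d j * z ^ 2 + w * (2 * z * e j)))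
        + (8 * (n : ℝ) ^ 2 * Lam ^ 2 / lam ^ 2 + 2) * (w ^ 2 * ∑ i, e i ^ 2) := by
  rcases Nat.eq_zero_or_pos n with rfl | hn
  · simp
  have hn' : (0 : ℝ) < n := by exact_mod_cast hn
  set D := ∑ i, (χ * d i * z) ^ 2 with hD
  set E := ∑ i, e i ^ 2 with hE
  set P := ∑ i, ∑ j, a i j * d i * (χ * d j * z ^ 2 + w * (2 * z * e j)) with hP
  have h1 : ∑ i, (χ * d i * z + w * e i) ^ 2 ≤ 2 * D + 2 * (w ^ 2 * E) := by
    rw [hD, hE, Finset.mul_sum, Finset.mul_sum, Finset.mul_sum, ← Finset.sum_add_distrib]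
    refine Finset.sum_le_sum fun i _ => ?_
    nlinarith [sq_nonneg (χ * d i * z - w * e i)]
  have h2 : lam / 2 * D - 2 * (n : ℝ) ^ 2 * Lam ^ 2 / lam * (w ^ 2 * E) ≤ P := by
    have e1 : P = (∑ i, ∑ j, a i j * (χ * d i * z) * (χ * d j * z))
        + ∑ i, ∑ j, 2 * (a i j * (χ * d i * z) * (w * e j)) := by
      rw [hP, ← Finset.sum_add_distrib]
      refine Finset.sum_congr rfl fun i _ => ?_
      rw [← Finset.sum_add_distrib]
      refine Finset.sum_congr rfl fun j _ => ?_
      -- Idempotence of χ and wχ = w turn the unrestricted gradient d into χd, so that ellipticity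
      -- can be applied to the vector χdz.
      linear_combination (-(a i j * d i * d j * z ^ 2)) * hχ - 2 * a i j * d i * z * e j * hw
    have e2 := hell fun i => χ * d i * z
    -- Young's inequality with weight lam/(2n): summed over i and j, the cross terms consume exactly
    -- half of the elliptic term.
    have e3 : ∀ i j, -(lam / (2 * n) * (χ * d i * z) ^ 2 + 2 * n * Lam ^ 2 / lam * (w ^ 2 * e j ^ 2))
        ≤ 2 * (a i j * (χ * d i * z) * (w * e j)) := by
      intro i j
      set X := χ * d i * z
      set Y := w * e j with hY
      have f1 : |2 * (a i j * X * Y)| ≤ 2 * (Lam * |X| * |Y|) := by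
        rw [abs_mul, abs_mul, abs_mul, abs_two]
        have := ha i j
        gcongr
      have f2 : 2 * (Lam * |X| * |Y|) ≤ lam / (2 * n) * X ^ 2 + 2 * n * Lam ^ 2 / lam * Y ^ 2 := by
        have f3 : 0 ≤ lam / (2 * n) * (|X| - 2 * n * Lam / lam * |Y|) ^ 2 := by positivity
        have f4 : lam / (2 * n) * (|X| - 2 * n * Lam / lam * |Y|) ^ 2
            = lam / (2 * n) * |X| ^ 2 + 2 * n * Lam ^ 2 / lam * |Y| ^ 2 - 2 * (Lam * |X| * |Y|) := by
          field_simp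
          ring
        rw [f4, sq_abs, sq_abs] at f3
        linarith
      have f5 : w ^ 2 * e j ^ 2 = Y ^ 2 := by rw [hY]; ring
      rw [f5]
      have := neg_le_of_abs_le f1
      linarith
    have e4 : -(lam / 2 * D + 2 * (n : ℝ) ^ 2 * Lam ^ 2 / lam * (w ^ 2 * E))
        ≤ ∑ i, ∑ j, 2 * (a i j * (χ * d i * z) * (w * e j)) := by
      refine le_trans (le_of_eq ?_)
        (Finset.sum_le_sum fun i _ => Finset.sum_le_sum fun j _ => e3 i j)
      simp only [Finset.sum_neg_distrib, Finset.sum_add_distrib, Finset.sum_const,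
        Finset.card_univ, Fintype.card_fin, nsmul_eq_mul, ← Finset.mul_sum]
      rw [← hD, ← hE]
      field_simp
    rw [e1]
    have e5 : lam / 2 * D = lam * D - lam / 2 * D := by ring
    linarith
  have h3 : 2 * D ≤ 4 / lam * P + 8 * (n : ℝ) ^ 2 * Lam ^ 2 / lam ^ 2 * (w ^ 2 * E) := by
    have := mul_le_mul_of_nonneg_left h2 (by positivity : 0 ≤ 4 / lam)
    have e6 : 4 / lam * (lam / 2 * D - 2 * (n : ℝ) ^ 2 * Lam ^ 2 / lam * (w ^ 2 * E))
        = 2 * D - 8 * (n : ℝ) ^ 2 * Lam ^ 2 / lam ^ 2 * (w ^ 2 * E) := by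
      field_simp
      ring
    linarith
  linarith

/-- The Caccioppoli inequality for `(u - κ)⁺ ζ`. -/
lemma caccioppoli {m : ℕ} {lam Lam K κ : ℝ} (hlam : 0 < lam) (hK : 0 < K)
    (hκ : K ≤ κ) (hκ' : κ ≤ 2 * K)
    {a : Fin (m + 2) → Fin (m + 2) → Space m → ℝ} {c c₁ g g₁ u β ζ : Space m → ℝ}
    (ham : ∀ i j, AEStronglyMeasurable (a i j) (muB m))
    (hab : ∀ i j, ∀ᵐ x ∂(muB m), |a i j x| ≤ Lam)
    (hell : ∀ᵐ x ∂(muB m), ∀ y : Space m,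
      lam * ∑ i, y i ^ 2 ≤ ∑ i, ∑ j, a i j x * y i * y j)
    (hc : AEStronglyMeasurable c (muB m)) (hg : AEStronglyMeasurable g (muB m))
    (hc₁ : AEStronglyMeasurable c₁ (sigmaN m)) (hg₁ : AEStronglyMeasurable g₁ (sigmaN m))
    (hβ : ∀ᵐ x ∂(muB m), |c x| + |g x| / K ≤ β x)
    (hβ₁ : ∀ᵐ x ∂(sigmaN m), |c₁ x| + |g₁ x| / K ≤ β x)
    (hu : HasH1Trace u (fun i => weakDeriv (domB m) i u))
    (hζ : IsTestFunction (cubeTop m) ζ)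
    (hw : WeakIneq a c c₁ g g₁ u (truncTest u κ ζ))
    (hΨ : Integrable (fun x => β x * (max (u x - κ) 0 ^ 2 +
      K ^ 2 * (if 0 < u x - κ then 1 else 0)) * ζ x ^ 2) (muBN m)) :
    ∑ i, ∫⁻ x, ‖truncGrad u (fun i => weakDeriv (domB m) i u) κ ζ i x‖ₑ ^ (2 : ℝ) ∂(muB m) ≤
      ENNReal.ofReal (8 / lam + (8 * ((m + 2 : ℕ) : ℝ) ^ 2 * Lam ^ 2 / lam ^ 2 + 2)) *
      ((∫⁻ x, ENNReal.ofReal (max (u x - κ) 0 ^ 2 * ∑ i, pderiv i ζ x ^ 2) ∂(muB m)) +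
        ∫⁻ x, ENNReal.ofReal (β x * (max (u x - κ) 0 ^ 2 +
      K ^ 2 * (if 0 < u x - κ then 1 else 0)) * ζ x ^ 2) ∂(muBN m)) := by
  set Du : Fin (m + 2) → Space m → ℝ := fun i => weakDeriv (domB m) i u with hDu
  set w : Space m → ℝ := fun x => max (u x - κ) 0 with hwdef
  set χ : Space m → ℝ := fun x => if 0 < u x - κ then 1 else 0 with hχdef
  set Ψ : Space m → ℝ := fun x => β x * (max (u x - κ) 0 ^ 2 +
      K ^ 2 * (if 0 < u x - κ then 1 else 0)) * ζ x ^ 2 with hΨdef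
  set v := truncTest u κ ζ with hv
  have hveq : v = fun x => w x * (ζ x ^ 2) := by
    funext x; simp only [hv, truncTest, hwdef, posPart_def]
  obtain ⟨M, hM, hM1, hM2⟩ := hζ.exists_bound
  have hleB : muB m ≤ muBN m := Measure.le_add_right le_rfl
  have hleN : sigmaN m ≤ muBN m := Measure.le_add_left le_rfl
  have hG := hu.truncate_mul κ hζ
  have hGv := hu.truncate_mul κ hζ.sq
  have hwd : ∀ j, weakDeriv (domB m) j v =ᵐ[muB m] truncGrad u Du κ (fun x => ζ x ^ 2) j := by
    intro j
    rw [hveq]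
    exact (hGv.isWeakDeriv j).weakDeriv_ae_eq (isOpen_domB m)
  set P : Space m → ℝ := fun x =>
    ∑ i, ∑ j, a i j x * Du i x * truncGrad u Du κ (fun x => ζ x ^ 2) j x with hP
  have hPint : Integrable P (muB m) := by
    refine integrable_finsetSum _ fun i _ => integrable_finsetSum _ fun j _ => ?_
    have h1 : Integrable (fun x => Du i x * truncGrad u Du κ (fun x => ζ x ^ 2) j x) (muB m) :=
      (hu.memLp_deriv i).integrable_mul (hGv.memLp_deriv j)
    have h2 := h1.bdd_mul (c := Lam) (ham i j) (hab i j)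
    simpa [mul_assoc] using h2
  have hvN : AEStronglyMeasurable v (muBN m) := by
    rw [hveq]
    exact hGv.meas
  -- This is where K ≤ κ ≤ 2K is used. Where w > 0 one has u = w + κ > 0 and uw ≤ w² + 2Kw ≤ 2(w² +
  -- K²), while |z|w = (|z|/K)·Kw; so both the coefficient term and the datum term are controlled by
  -- β(w² + K²)ζ².
  have ptw : ∀ (x : Space m) (y z : ℝ), |y| + |z| / K ≤ β x →
      |y * u x * v x| ≤ 2 * Ψ x ∧ |z * v x| ≤ 2 * Ψ x ∧ z * v x - y * u x * v x ≤ 2 * Ψ x := by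
    intro x y z hyz
    have hβx : 0 ≤ β x := le_trans (by positivity) hyz
    have hvx : v x = w x * ζ x ^ 2 := by rw [hveq]
    suffices h : |y * u x * v x| + |z * v x| ≤ 2 * Ψ x by
      have h1 := abs_nonneg (y * u x * v x)
      have h2 := abs_nonneg (z * v x)
      have h3 := neg_abs_le (y * u x * v x)
      have h4 := le_abs_self (z * v x)
      exact ⟨by linarith, by linarith, by linarith⟩
    rcases le_or_gt (u x - κ) 0 with h0 | h0
    · have hw0 : w x = 0 := max_eq_right h0
      have : (0 : ℝ) ≤ if 0 < u x - κ then 1 else 0 := by split_ifs <;> norm_num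
      have hΨx : 0 ≤ Ψ x := by simp only [hΨdef]; positivity
      rw [hvx, hw0]
      simpa using hΨx
    · have hwx : w x = u x - κ := max_eq_left h0.le
      have hΨx : Ψ x = β x * (w x ^ 2 + K ^ 2) * ζ x ^ 2 := by
        simp only [hΨdef, hwdef, if_pos h0, mul_one]
      have hwp : 0 < w x := hwx ▸ h0
      have hux : u x = w x + κ := by rw [hwx]; ring
      have hup : 0 < u x := by linarith
      rw [hΨx, hvx, abs_mul (y * u x), abs_mul y, abs_mul z, abs_of_pos hup,
        abs_of_nonneg (by positivity : 0 ≤ w x * ζ x ^ 2)]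
      have e1 : u x * w x ≤ 2 * (w x ^ 2 + K ^ 2) := by
        rw [hux]
        nlinarith [sq_nonneg (w x - K), mul_le_mul_of_nonneg_left hκ' hwp.le]
      have e2 : K * w x ≤ 2 * (w x ^ 2 + K ^ 2) := by nlinarith [sq_nonneg (w x - K)]
      have e3 : |z| = |z| / K * K := by field_simp
      calc |y| * u x * (w x * ζ x ^ 2) + |z| * (w x * ζ x ^ 2)
          = (|y| * (u x * w x) + |z| / K * (K * w x)) * ζ x ^ 2 := by
            conv_lhs => rw [e3]
            ring
        _ ≤ (|y| * (2 * (w x ^ 2 + K ^ 2)) + |z| / K * (2 * (w x ^ 2 + K ^ 2))) * ζ x ^ 2 := by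
            gcongr
        _ = (|y| + |z| / K) * (2 * (w x ^ 2 + K ^ 2)) * ζ x ^ 2 := by ring
        _ ≤ β x * (2 * (w x ^ 2 + K ^ 2)) * ζ x ^ 2 := by gcongr
        _ = _ := by ring
  -- Integrability has to be secured before `WeakIneq` is taken apart, since a Bochner integral of a
  -- non-integrable function is 0 by convention.
  have hcuv : Integrable (fun x => c x * u x * v x) (muB m) := by
    refine ((hΨ.mono_measure hleB).const_mul 2).mono'
      ((hc.mul (hu.memLp.1.mono_measure hleB)).mul (hvN.mono_measure hleB)) ?_
    filter_upwards [hβ] with x hx using (ptw x _ _ hx).1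
  have hgv : Integrable (fun x => g x * v x) (muB m) := by
    refine ((hΨ.mono_measure hleB).const_mul 2).mono' (hg.mul (hvN.mono_measure hleB)) ?_
    filter_upwards [hβ] with x hx using (ptw x _ _ hx).2.1
  have hcuv₁ : Integrable (fun x => c₁ x * u x * v x) (sigmaN m) := by
    refine ((hΨ.mono_measure hleN).const_mul 2).mono'
      ((hc₁.mul (hu.memLp.1.mono_measure hleN)).mul (hvN.mono_measure hleN)) ?_
    filter_upwards [hβ₁] with x hx using (ptw x _ _ hx).1
  have hgv₁ : Integrable (fun x => g₁ x * v x) (sigmaN m) := by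
    refine ((hΨ.mono_measure hleN).const_mul 2).mono' (hg₁.mul (hvN.mono_measure hleN)) ?_
    filter_upwards [hβ₁] with x hx using (ptw x _ _ hx).2.1
  have hPle : ∫ x, P x ∂(muB m) ≤ 2 * ∫ x, Ψ x ∂(muBN m) := by
    have h1 : (∫ x, P x ∂(muB m)) + (∫ x, c x * u x * v x ∂(muB m))
        + ∫ x, c₁ x * u x * v x ∂(sigmaN m)
        ≤ (∫ x, g x * v x ∂(muB m)) + ∫ x, g₁ x * v x ∂(sigmaN m) := by
      rw [← integral_add hPint hcuv]
      refine le_trans (le_of_eq ?_) hw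
      congr 1
      refine integral_congr_ae ?_
      filter_upwards [ae_all_iff.2 hwd] with x hx
      simp only [hP, hx, hDu]
    have h2 : (∫ x, g x * v x ∂(muB m)) - (∫ x, c x * u x * v x ∂(muB m))
        ≤ ∫ x, 2 * Ψ x ∂(muB m) := by
      rw [← integral_sub hgv hcuv]
      refine integral_mono_ae (hgv.sub hcuv) ((hΨ.mono_measure hleB).const_mul 2) ?_
      filter_upwards [hβ] with x hx using (ptw x _ _ hx).2.2
    have h3 : (∫ x, g₁ x * v x ∂(sigmaN m)) - (∫ x, c₁ x * u x * v x ∂(sigmaN m))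
        ≤ ∫ x, 2 * Ψ x ∂(sigmaN m) := by
      rw [← integral_sub hgv₁ hcuv₁]
      refine integral_mono_ae (hgv₁.sub hcuv₁) ((hΨ.mono_measure hleN).const_mul 2) ?_
      filter_upwards [hβ₁] with x hx using (ptw x _ _ hx).2.2
    have h4 : ∫ x, 2 * Ψ x ∂(muBN m) = (∫ x, 2 * Ψ x ∂(muB m)) + ∫ x, 2 * Ψ x ∂(sigmaN m) :=
      integral_add_measure ((hΨ.mono_measure hleB).const_mul 2)
        ((hΨ.mono_measure hleN).const_mul 2)
    rw [integral_const_mul] at h4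
    linarith
  have hβ0 : ∀ᵐ x ∂(muBN m), 0 ≤ β x := by
    rw [muBN, ae_add_measure_iff]
    constructor
    · filter_upwards [hβ] with x hx using le_trans (by positivity) hx
    · filter_upwards [hβ₁] with x hx using le_trans (by positivity) hx
  have hΨ0 : 0 ≤ᵐ[muBN m] Ψ := by
    filter_upwards [hβ0] with x hx
    simp only [hΨdef, Pi.zero_apply]
    have : (0 : ℝ) ≤ if 0 < u x - κ then 1 else 0 := by split_ifs <;> norm_num
    positivity
  set R : Space m → ℝ := fun x => w x ^ 2 * ∑ i, pderiv i ζ x ^ 2 with hR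
  have hR0 : ∀ x, 0 ≤ R x := fun x => by positivity
  have hw2 : MemLp w 2 (muB m) := by
    have h1 : MemLp (fun x => u x - κ) 2 (muB m) :=
      (hu.memLp.sub (memLp_const κ)).mono_measure hleB
    exact h1.pos_part
  have hRint : Integrable R (muB m) := by
    have h1 : Integrable (fun x => w x ^ 2) (muB m) := hw2.integrable_sq
    refine h1.mul_bdd (c := ∑ _i : Fin (m + 2), M ^ 2) ?_ (ae_of_all _ fun x => ?_)
    · exact (continuous_finsetSum _ fun i _ =>
        (hζ.continuous_pderiv i).pow 2).aestronglyMeasurable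
    · rw [Real.norm_of_nonneg (by positivity)]
      refine Finset.sum_le_sum fun i _ => ?_
      rw [← sq_abs]
      exact pow_le_pow_left₀ (abs_nonneg _) (hM2 i x) 2
  have hpt : ∀ᵐ x ∂(muB m), ∑ i, truncGrad u Du κ ζ i x ^ 2 ≤
      4 / lam * P x + (8 * ((m + 2 : ℕ) : ℝ) ^ 2 * Lam ^ 2 / lam ^ 2 + 2) * R x := by
    filter_upwards [hell, ae_all_iff.2 fun i => ae_all_iff.2 (hab i)] with x h1 h2
    have hχ2 : χ x ^ 2 = χ x := by simp only [hχdef]; split_ifs <;> norm_num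
    have hwχ : w x * χ x = w x := by
      simp only [hχdef, hwdef]
      split_ifs with h
      · rw [mul_one]
      · rw [max_eq_right (not_lt.1 h), zero_mul]
    have := sum_sq_le_of_elliptic (z := ζ x) (d := fun i => Du i x) (e := fun i => pderiv i ζ x)
      hlam hχ2 hwχ h2 h1
    simpa only [truncGrad, hP, hR, hζ.pderiv_sq] using this
  have hGint : ∀ i, Integrable (fun x => truncGrad u Du κ ζ i x ^ 2) (muB m) := fun i =>
    (hG.memLp_deriv i).integrable_sq
  -- The 8/lam is 4/lam from ellipticity times 2 from `hPle`; the two constants are added so that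
  -- one factor serves both integrals.
  have hfin : ∫ x, ∑ i, truncGrad u Du κ ζ i x ^ 2 ∂(muB m) ≤
      (8 / lam + (8 * ((m + 2 : ℕ) : ℝ) ^ 2 * Lam ^ 2 / lam ^ 2 + 2)) *
        ((∫ x, R x ∂(muB m)) + ∫ x, Ψ x ∂(muBN m)) := by
    have h1 := integral_mono_ae (integrable_finsetSum _ fun i _ => hGint i)
      ((hPint.const_mul (4 / lam)).add (hRint.const_mul
        (8 * ((m + 2 : ℕ) : ℝ) ^ 2 * Lam ^ 2 / lam ^ 2 + 2))) hpt
    simp only [Pi.add_apply] at h1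
    rw [integral_add (hPint.const_mul _) (hRint.const_mul _), integral_const_mul,
      integral_const_mul] at h1
    have h2 := mul_le_mul_of_nonneg_left hPle (by positivity : 0 ≤ 4 / lam)
    have h3 : 0 ≤ ∫ x, R x ∂(muB m) := integral_nonneg hR0
    have h4 : 0 ≤ ∫ x, Ψ x ∂(muBN m) := integral_nonneg_of_ae hΨ0
    have h5 : 4 / lam * (2 * ∫ x, Ψ x ∂(muBN m)) = 8 / lam * ∫ x, Ψ x ∂(muBN m) := by ring
    have h6 : 0 ≤ 8 / lam := by positivity
    have h7 : 0 ≤ 8 * ((m + 2 : ℕ) : ℝ) ^ 2 * Lam ^ 2 / lam ^ 2 + 2 := by positivity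
    have h8 := mul_nonneg h6 h3
    have h9 := mul_nonneg h7 h4
    linarith
  have hlhs : ∑ i, ∫⁻ x, ‖truncGrad u Du κ ζ i x‖ₑ ^ (2 : ℝ) ∂(muB m)
      = ENNReal.ofReal (∫ x, ∑ i, truncGrad u Du κ ζ i x ^ 2 ∂(muB m)) := by
    rw [integral_finsetSum _ fun i _ => hGint i,
      ENNReal.ofReal_sum_of_nonneg fun i _ => integral_nonneg fun x => sq_nonneg _]
    refine Finset.sum_congr rfl fun i _ => ?_
    rw [ofReal_integral_eq_lintegral_ofReal (hGint i) (ae_of_all _ fun x => sq_nonneg _)]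
    refine lintegral_congr fun x => ?_
    rw [← sq_abs, ENNReal.ofReal_pow (abs_nonneg _), Real.enorm_eq_ofReal_abs]
    norm_cast
  rw [hlhs, ← ofReal_integral_eq_lintegral_ofReal hRint (ae_of_all _ hR0),
    ← ofReal_integral_eq_lintegral_ofReal hΨ hΨ0,
    ← ENNReal.ofReal_add (integral_nonneg hR0) (integral_nonneg_of_ae hΨ0),
    ← ENNReal.ofReal_mul (by positivity)]
  exact ENNReal.ofReal_le_ofReal hfin

/-! ### One step of the iteration. -/

/-- The coefficients are bounded and elliptic, and `u` is a subsolution of the mixed problem. -/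
structure IsSubsolution {m : ℕ} (lam Lam : ℝ) (a : Fin (m + 2) → Fin (m + 2) → Space m → ℝ)
    (c c₁ g g₁ u : Space m → ℝ) : Prop where
  meas : ∀ i j, AEStronglyMeasurable (a i j) (muB m)
  bound : ∀ i j, ∀ᵐ x ∂(muB m), |a i j x| ≤ Lam
  elliptic : ∀ᵐ x ∂(muB m), ∀ y : Space m,
    lam * ∑ i, y i ^ 2 ≤ ∑ i, ∑ j, a i j x * y i * y j
  meas_c : AEStronglyMeasurable c (muB m)
  meas_g : AEStronglyMeasurable g (muB m)
  meas_c₁ : AEStronglyMeasurable c₁ (sigmaN m)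
  meas_g₁ : AEStronglyMeasurable g₁ (sigmaN m)
  hasH1Trace : HasH1Trace u (fun i => weakDeriv (domB m) i u)
  ineq : ∀ k : ℝ, 0 ≤ k → ∀ ζ : Space m → ℝ, IsTestFunction (cubeTop m) ζ →
    (∀ x, 0 ≤ ζ x) → WeakIneq a c c₁ g g₁ u (truncTest u k ζ)

/-- Hölder's inequality after splitting `b` at height `T`. -/
lemma lintegral_mul_sq_le {α : Type*} [MeasurableSpace α] {ν : Measure α} {m : ℕ} (hm : 1 ≤ m)
    {s : ℝ} (hs : (m : ℝ) + 1 < s) {b F : α → ℝ≥0∞} (hb : AEMeasurable b ν)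
    (hF : AEMeasurable F ν) {T : ℝ≥0∞} (hT : T ≠ 0) (hT' : T ≠ ⊤) :
    ∫⁻ x, b x * F x ^ (2 : ℝ) ∂ν ≤ T * ∫⁻ x, F x ^ (2 : ℝ) ∂ν +
      (T ^ (-(s - (m + 1))) * ∫⁻ x, b x ^ s ∂ν) ^ (1 / ((m : ℝ) + 1)) *
        (∫⁻ x, F x ^ traceExp m ∂ν) ^ (2 / traceExp m) := by
  have hm' : (1 : ℝ) ≤ m := by exact_mod_cast hm
  have hF2 : AEMeasurable (fun x => F x ^ (2 : ℝ)) ν := hF.pow_const _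
  have hconj : Real.HolderConjugate ((m : ℝ) + 1) (((m : ℝ) + 1) / m) := by
    rw [Real.holderConjugate_iff]
    refine ⟨by linarith, ?_⟩
    field_simp
    ring
  -- Where b > T, b^(m+1) ≤ T^(-(s-m-1)) b^s; hence the truncated part is small in L^(m+1) for large
  -- T. The conjugate exponent (m+1)/m turns F² into F^r.
  set b' : α → ℝ≥0∞ := fun x => if T < b x then b x else 0 with hb'
  have hb'm : AEMeasurable b' ν := by
    have : Measurable fun t : ℝ≥0∞ => if T < t then t else 0 :=
      Measurable.ite measurableSet_Ioi measurable_id measurable_const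
    exact this.comp_aemeasurable hb
  have h1 : ∀ x, b x * F x ^ (2 : ℝ) ≤ T * F x ^ (2 : ℝ) + b' x * F x ^ (2 : ℝ) := by
    intro x
    rw [← add_mul]
    refine mul_le_mul_left ?_ _
    simp only [hb']
    split_ifs with h
    · exact le_add_self
    · rw [add_zero]; exact not_lt.1 h
  have h2 : ∀ x, b' x ^ ((m : ℝ) + 1) ≤ T ^ (-(s - (m + 1))) * b x ^ s := by
    intro x
    simp only [hb']
    split_ifs with h
    · rw [ENNReal.rpow_neg, mul_comm, ← div_eq_mul_inv, ENNReal.le_div_iff_mul_le]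
      · calc b x ^ ((m : ℝ) + 1) * T ^ (s - (m + 1))
            ≤ b x ^ ((m : ℝ) + 1) * b x ^ (s - (m + 1)) := by
              refine mul_le_mul_right (ENNReal.rpow_le_rpow h.le (by linarith)) _
          _ = b x ^ s := by
              rw [← ENNReal.rpow_add_of_nonneg _ _ (by linarith) (by linarith)]
              congr 1; ring
      · left; simp [hT, hT']
      · left
        exact ENNReal.rpow_ne_top_of_nonneg (by linarith) hT'
    · rw [ENNReal.zero_rpow_of_pos (by linarith)]; exact zero_le
  calc ∫⁻ x, b x * F x ^ (2 : ℝ) ∂ν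
      ≤ ∫⁻ x, (T * F x ^ (2 : ℝ) + b' x * F x ^ (2 : ℝ)) ∂ν := lintegral_mono h1
    _ = T * ∫⁻ x, F x ^ (2 : ℝ) ∂ν + ∫⁻ x, b' x * F x ^ (2 : ℝ) ∂ν := by
        rw [lintegral_add_left' (hF2.const_mul _), lintegral_const_mul'' _ hF2]
    _ ≤ _ := by
        gcongr
        refine (ENNReal.lintegral_mul_le_Lp_mul_Lq ν hconj hb'm hF2).trans ?_
        refine mul_le_mul' (ENNReal.rpow_le_rpow ?_ (by positivity)) (le_of_eq ?_)
        · refine (lintegral_mono h2).trans (le_of_eq ?_)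
          rw [lintegral_const_mul'' _ (hb.pow_const _)]
        · congr 1
          · refine lintegral_congr fun x => ?_
            rw [← ENNReal.rpow_mul]
            congr 1
            rw [traceExp]; ring
          · rw [traceExp]; field_simp

/-- Absorption into the left side. Finiteness of x is essential: ⊤ satisfies the inequality whenever
τ ≠ 0. -/
lemma le_two_mul_of_le_add_mul {x A τ : ℝ≥0∞} (hx : x ≠ ⊤) (h : x ≤ A + τ * x) (hτ : τ ≤ 1 / 2) :
    x ≤ 2 * A := by
  have h1 : x ≤ A + x / 2 := h.trans (by
    gcongr
    calc τ * x ≤ 1 / 2 * x := by gcongr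
      _ = x / 2 := by rw [one_div, mul_comm, ENNReal.div_eq_inv_mul, mul_comm])
  have h2 : x / 2 + x / 2 ≤ A + x / 2 := by rwa [ENNReal.add_halves]
  have h3 : x / 2 ≤ A := (ENNReal.add_le_add_iff_right (ENNReal.div_ne_top hx two_ne_zero)).1 h2
  calc x = x / 2 + x / 2 := (ENNReal.add_halves x).symm
    _ ≤ A + A := add_le_add h3 h3
    _ = 2 * A := (two_mul A).symm

/-- The basic step of De Giorgi's iteration. -/
lemma exists_iteration_const {m : ℕ} (hm : 1 ≤ m) {lam : ℝ} (hlam : 0 < lam) (Lam : ℝ) {s : ℝ}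
    (hs : (m : ℝ) + 1 < s) {M : ℝ≥0∞} (hM : M ≠ ⊤) :
    ∃ C : ℝ≥0∞, C ≠ ⊤ ∧ ∀ (a : Fin (m + 2) → Fin (m + 2) → Space m → ℝ)
      (c c₁ g g₁ u : Space m → ℝ), IsSubsolution lam Lam a c c₁ g g₁ u →
      ∀ (K : ℝ) (β : Space m → ℝ), 0 < K → AEStronglyMeasurable β (muBN m) →
      (∀ᵐ x ∂(muB m), |c x| + |g x| / K ≤ β x) →
      (∀ᵐ x ∂(sigmaN m), |c₁ x| + |g₁ x| / K ≤ β x) →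
      ∫⁻ x, ‖β x‖ₑ ^ s ∂(muBN m) ≤ M →
      ∀ (κ : ℝ) (ζ : Space m → ℝ) (S : Set (Space m)) (L : ℝ), K ≤ κ → κ ≤ 2 * K →
      IsTestFunction (cubeTop m) ζ → (∀ x, 0 ≤ ζ x) → (∀ x, ζ x ≤ 1) → MeasurableSet S →
      (∀ x, x ∉ S → ζ x = 0) → 1 ≤ L →
      (∀ x, ∑ i, pderiv i ζ x ^ 2 ≤ S.indicator (fun _ => L ^ 2) x) →
      ∫⁻ x, ‖max (u x - κ) 0 * ζ x‖ₑ ^ (2 : ℝ) ∂(muBN m) ≤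
        C * (ENNReal.ofReal (L ^ 2) * (∫⁻ x in S, ‖max (u x - κ) 0‖ₑ ^ (2 : ℝ) ∂(muBN m)) +
          ENNReal.ofReal (K ^ 2) *
            (∫⁻ x in S, (if κ < u x then 1 else 0) ∂(muBN m)) ^ (1 - 1 / s)) *
          (∫⁻ x in S, (if κ < u x then 1 else 0) ∂(muBN m)) ^ (1 / ((m : ℝ) + 1)) := by
  have hm' : (1 : ℝ) ≤ m := by exact_mod_cast hm
  have hr := traceExp_gt_two hm
  obtain ⟨Cs, hCs, hsob⟩ := exists_sobolev_const hm
  set r := traceExp m with hrdef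
  set C1 : ℝ≥0∞ := ENNReal.ofReal (8 / lam + (8 * ((m + 2 : ℕ) : ℝ) ^ 2 * Lam ^ 2 / lam ^ 2 + 2))
  set C2 : ℝ≥0∞ := Cs ^ (2 : ℝ) * (((m + 2 : ℕ) : ℝ≥0∞) * C1) with hC2
  have hC2top : C2 ≠ ⊤ := ENNReal.mul_ne_top (ENNReal.rpow_ne_top_of_nonneg (by norm_num) hCs)
    (ENNReal.mul_ne_top (ENNReal.natCast_ne_top _) ENNReal.ofReal_ne_top)
  -- C2 combines the Sobolev and Caccioppoli constants. T is made so large that the part of β above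
  -- T contributes at most half of the Sobolev norm; it depends on β only through the bound M.
  obtain ⟨T, hT0, hTtop, hT⟩ : ∃ T : ℝ≥0∞, T ≠ 0 ∧ T ≠ ⊤ ∧
      C2 * (T ^ (-(s - (m + 1))) * M) ^ (1 / ((m : ℝ) + 1)) ≤ 1 / 2 := by
    have hδ : 0 < s - (m + 1) := by linarith
    set θ : ℝ≥0∞ := (2 * (C2 + 1))⁻¹ with hθ
    have hC21 : C2 + 1 ≠ ⊤ := ENNReal.add_ne_top.2 ⟨hC2top, by norm_num⟩
    have hθ0 : θ ≠ 0 := ENNReal.inv_ne_zero.2 (ENNReal.mul_ne_top (by norm_num) hC21)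
    have hθtop : θ ≠ ⊤ := ENNReal.inv_ne_top.2 (by simp)
    set η : ℝ≥0∞ := θ ^ ((m : ℝ) + 1) / (M + 1) with hη
    have hM1 : M + 1 ≠ ⊤ := ENNReal.add_ne_top.2 ⟨hM, by norm_num⟩
    have hη0 : η ≠ 0 := ENNReal.div_ne_zero.2 ⟨by simp [hθ0, hθtop], hM1⟩
    have hηtop : η ≠ ⊤ := ENNReal.div_ne_top
      (ENNReal.rpow_ne_top_of_nonneg (by positivity) hθtop) (by simp)
    refine ⟨η ^ (-(1 / (s - (m + 1)))), ?_, ?_, ?_⟩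
    · simp [ENNReal.rpow_eq_zero_iff, hη0, hηtop]
    · simp [ENNReal.rpow_eq_top_iff, hη0, hηtop]
    · have e1 : (η ^ (-(1 / (s - (m + 1))))) ^ (-(s - (m + 1))) = η := by
        rw [← ENNReal.rpow_mul]
        have : -(1 / (s - (m + 1))) * -(s - (m + 1)) = 1 := by field_simp
        rw [this, ENNReal.rpow_one]
      have e2 : η * M ≤ θ ^ ((m : ℝ) + 1) := by
        calc η * M ≤ η * (M + 1) := by gcongr; exact le_self_add
          _ = _ := ENNReal.div_mul_cancel (by simp) hM1
      rw [e1]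
      calc C2 * (η * M) ^ (1 / ((m : ℝ) + 1))
          ≤ C2 * (θ ^ ((m : ℝ) + 1)) ^ (1 / ((m : ℝ) + 1)) := by gcongr
        _ = C2 * θ := by
            rw [← ENNReal.rpow_mul, mul_one_div_cancel (by positivity), ENNReal.rpow_one]
        _ ≤ (C2 + 1) * θ := by gcongr; exact le_self_add
        _ = 1 / 2 := by
            rw [hθ, ENNReal.mul_inv (Or.inl two_ne_zero) (Or.inl ENNReal.ofNat_ne_top),
              mul_comm (2 : ℝ≥0∞)⁻¹, ← mul_assoc,
              ENNReal.mul_inv_cancel (by simp) hC21, one_mul, one_div]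
  refine ⟨2 * C2 * (1 + T + M ^ (1 / s)), ?_, ?_⟩
  · refine ENNReal.mul_ne_top (ENNReal.mul_ne_top (by norm_num) hC2top) ?_
    refine ENNReal.add_ne_top.2 ⟨ENNReal.add_ne_top.2 ⟨by norm_num, hTtop⟩, ?_⟩
    exact ENNReal.rpow_ne_top_of_nonneg (by
      have : 0 < s := by linarith
      positivity) hM
  intro a c c₁ g g₁ u hsol K β hK hβm hβ hβ₁ hβs κ ζ S L hκ hκ' hζ hζ0 hζ1 hS hζS hL hgrad
  have hs0 : 0 < s := by linarith
  set μ := muBN m with hμ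
  have hu := hsol.hasH1Trace
  set Du : Fin (m + 2) → Space m → ℝ := fun i => weakDeriv (domB m) i u with hDu
  have hG := hu.truncate_mul κ hζ
  set f : Space m → ℝ := fun x => max (u x - κ) 0 * ζ x with hf
  set G := truncGrad u Du κ ζ with hGdef
  set χ : Space m → ℝ≥0∞ := S.indicator fun x => if κ < u x then 1 else 0 with hχ
  have hstep : AEMeasurable (fun x => if κ < u x then (1 : ℝ≥0∞) else 0) μ := by
    have : Measurable fun t : ℝ => if κ < t then (1 : ℝ≥0∞) else 0 :=
      Measurable.ite measurableSet_Ioi measurable_const measurable_const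
    exact this.comp_aemeasurable hu.memLp.1.aemeasurable
  have hχm : AEMeasurable χ μ := hstep.indicator hS
  have hχp : ∀ (p : ℝ), 0 < p → ∀ x, χ x ^ p = χ x := by
    intro p hp x
    by_cases hx : x ∈ S
    · simp only [hχ, indicator_of_mem hx]
      split_ifs <;> simp [hp]
    · simp [hχ, indicator_of_notMem hx, hp]
  set A : ℝ≥0∞ := ∫⁻ x in S, (if κ < u x then 1 else 0) ∂μ with hA
  have hAχ : ∫⁻ x, χ x ∂μ = A := by rw [hA, hχ, lintegral_indicator hS]
  have hAtop : A ≠ ⊤ := by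
    have : A ≤ ∫⁻ _ in S, 1 ∂μ := lintegral_mono fun x => by split_ifs <;> simp
    refine (this.trans_lt ?_).ne
    rw [setLIntegral_one]
    exact measure_lt_top _ _
  set W : ℝ≥0∞ := ∫⁻ x in S, ‖max (u x - κ) 0‖ₑ ^ (2 : ℝ) ∂μ with hW
  set F : Space m → ℝ≥0∞ := fun x => ‖f x‖ₑ with hFdef
  have hFm : AEMeasurable F μ := hG.meas.enorm
  set b : Space m → ℝ≥0∞ := fun x => ‖β x‖ₑ with hbdef
  have hbm : AEMeasurable b μ := hβm.enorm
  set N : ℝ≥0∞ := (∫⁻ x, F x ^ r ∂μ) ^ (2 / r) with hN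
  have hN' : N = eLpNorm f (ENNReal.ofReal r) μ ^ (2 : ℝ) := by
    rw [eLpNorm_eq_lintegral_rpow_enorm_toReal (by simp; linarith) ENNReal.ofReal_ne_top,
      ENNReal.toReal_ofReal (by linarith), ← ENNReal.rpow_mul, hN]
    congr 1
    ring
  have hI : ∀ i, eLpNorm (G i) 2 (muB m) ^ (2 : ℝ) = ∫⁻ x, ‖G i x‖ₑ ^ (2 : ℝ) ∂(muB m) := by
    intro i
    rw [eLpNorm_eq_lintegral_rpow_enorm_toReal (by norm_num) (by norm_num), ← ENNReal.rpow_mul]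
    simp
  have hNle : N ≤ Cs ^ (2 : ℝ) * (((m + 2 : ℕ) : ℝ≥0∞) *
      ∑ i, ∫⁻ x, ‖G i x‖ₑ ^ (2 : ℝ) ∂(muB m)) := by
    rw [hN']
    refine (ENNReal.rpow_le_rpow (hsob f G hG) (by norm_num)).trans ?_
    rw [ENNReal.mul_rpow_of_nonneg _ _ (by norm_num)]
    gcongr
    refine (ENNReal.rpow_sum_le_const_mul_sum_rpow (s := Finset.univ) _ (by norm_num)).trans ?_
    simp only [hI, Finset.card_univ, Fintype.card_fin]
    norm_num
  -- Needed both for the integrability of Ψ and for the absorption.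
  have hNtop : N ≠ ⊤ := by
    refine (hNle.trans_lt ?_).ne
    refine ENNReal.mul_lt_top (ENNReal.rpow_lt_top_of_nonneg (by norm_num) hCs)
      (ENNReal.mul_lt_top (ENNReal.natCast_lt_top _) (ENNReal.sum_lt_top.2 fun i _ => ?_))
    rw [← hI]
    exact ENNReal.rpow_lt_top_of_nonneg (by norm_num) (hG.memLp_deriv i).2.ne
  have hF2W : ∫⁻ x, F x ^ (2 : ℝ) ∂μ ≤ W := by
    rw [hW, ← lintegral_indicator hS]
    refine lintegral_mono fun x => ?_
    by_cases hx : x ∈ S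
    · rw [indicator_of_mem hx]
      refine ENNReal.rpow_le_rpow ?_ (by norm_num)
      refine enorm_le_iff_norm_le.2 ?_
      simp only [hf, Real.norm_eq_abs, abs_mul, abs_of_nonneg (hζ0 x)]
      exact mul_le_of_le_one_right (abs_nonneg _) (hζ1 x)
    · simp [hFdef, hf, hζS x hx]
  have hWtop : W ≠ ⊤ := by
    have h1 : MemLp (fun x => max (u x - κ) 0) 2 μ := (hu.memLp.sub (memLp_const κ)).pos_part
    have h2 := lintegral_rpow_enorm_lt_top_of_eLpNorm_lt_top (by norm_num) (by norm_num) h1.2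
    simp only [ENNReal.toReal_ofNat] at h2
    exact ((lintegral_mono' Measure.restrict_le_self le_rfl).trans_lt h2).ne
  have hbF : ∫⁻ x, b x * F x ^ (2 : ℝ) ∂μ ≤ T * W +
      (T ^ (-(s - (m + 1))) * M) ^ (1 / ((m : ℝ) + 1)) * N := by
    refine (lintegral_mul_sq_le hm hs hbm hFm hT0 hTtop).trans ?_
    gcongr
  -- Hölder's inequality with exponent s on an indicator function, whose powers are all equal to
  -- itself; this gives the data term its power of A.
  have hbχ : ∫⁻ x, b x * χ x ∂μ ≤ M ^ (1 / s) * A ^ (1 - 1 / s) := by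
    have hconj : Real.HolderConjugate s (s / (s - 1)) := by
      rw [Real.holderConjugate_iff]
      have : s - 1 ≠ 0 := by linarith
      refine ⟨by linarith, ?_⟩
      field_simp
      ring
    refine (ENNReal.lintegral_mul_le_Lp_mul_Lq μ hconj hbm hχm).trans ?_
    have hp : 0 < s / (s - 1) := hconj.symm.pos
    simp only [hχp _ hp, hAχ]
    have e : 1 / (s / (s - 1)) = 1 - 1 / s := by
      have : s - 1 ≠ 0 := by linarith
      field_simp
    rw [e]
    gcongr
  set Ψ : Space m → ℝ := fun x => β x * (max (u x - κ) 0 ^ 2 +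
      K ^ 2 * (if 0 < u x - κ then 1 else 0)) * ζ x ^ 2 with hΨ
  have hΨm : AEStronglyMeasurable Ψ μ := by
    have h1 : AEStronglyMeasurable (fun x => u x - κ) μ := hu.memLp.1.sub aestronglyMeasurable_const
    have h2 : AEStronglyMeasurable (fun x => max (u x - κ) 0) μ :=
      (by fun_prop : Continuous fun t : ℝ => max t 0).comp_aestronglyMeasurable h1
    have h3 : AEStronglyMeasurable (fun x => if 0 < u x - κ then (1 : ℝ) else 0) μ := by
      have : Measurable fun t : ℝ => if 0 < t then (1 : ℝ) else 0 :=
        Measurable.ite measurableSet_Ioi measurable_const measurable_const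
      exact (this.comp_aemeasurable h1.aemeasurable).aestronglyMeasurable
    exact (hβm.mul ((h2.pow 2).add (h3.const_mul _))).mul
      (hζ.smooth.continuous.pow 2).aestronglyMeasurable
  have hΨle : ∀ x, ‖Ψ x‖ₑ ≤ b x * F x ^ (2 : ℝ) + ENNReal.ofReal (K ^ 2) * (b x * χ x) := by
    intro x
    have e1 : Ψ x = β x * f x ^ 2 + K ^ 2 * (β x * ((if 0 < u x - κ then 1 else 0) * ζ x ^ 2)) := by
      simp only [hΨ, hf]; ring
    rw [e1]
    refine (enorm_add_le _ _).trans ?_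
    rw [enorm_mul, enorm_mul, enorm_mul, enorm_pow, Real.enorm_of_nonneg (sq_nonneg K)]
    refine add_le_add (le_of_eq ?_) ?_
    · simp only [hbdef, hFdef]
      norm_cast
    · refine mul_le_mul_right (mul_le_mul_right ?_ _) _
      by_cases hx : x ∈ S
      · simp only [hχ, indicator_of_mem hx, sub_pos]
        split_ifs
        · rw [one_mul, Real.enorm_of_nonneg (sq_nonneg _)]
          exact ENNReal.ofReal_le_one.2 (pow_le_one₀ (hζ0 x) (hζ1 x))
        · simp
      · simp [hζS x hx]
  have hΨint : ∫⁻ x, ‖Ψ x‖ₑ ∂μ ≤ T * W +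
      (T ^ (-(s - (m + 1))) * M) ^ (1 / ((m : ℝ) + 1)) * N +
        ENNReal.ofReal (K ^ 2) * (M ^ (1 / s) * A ^ (1 - 1 / s)) := by
    refine (lintegral_mono hΨle).trans ?_
    have hm1 : AEMeasurable (fun x => b x * F x ^ (2 : ℝ)) μ := hbm.mul (hFm.pow_const _)
    have hm2 : AEMeasurable (fun x => b x * χ x) μ := hbm.mul hχm
    rw [lintegral_add_left' hm1, lintegral_const_mul'' _ hm2]
    gcongr
  have hexp : 0 ≤ 1 - 1 / s := by
    rw [sub_nonneg, div_le_one hs0]; linarith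
  have hΨI : Integrable Ψ μ := by
    refine ⟨hΨm, hΨint.trans_lt ?_⟩
    refine ENNReal.add_lt_top.2 ⟨ENNReal.add_lt_top.2 ⟨?_, ?_⟩, ?_⟩
    · exact ENNReal.mul_lt_top hTtop.lt_top hWtop.lt_top
    · refine ENNReal.mul_lt_top (ENNReal.rpow_lt_top_of_nonneg (by positivity)
        (ENNReal.mul_ne_top ?_ hM)) hNtop.lt_top
      simp [ENNReal.rpow_eq_top_iff, hT0, hTtop]
    · exact ENNReal.mul_lt_top ENNReal.ofReal_lt_top (ENNReal.mul_lt_top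
        (ENNReal.rpow_lt_top_of_nonneg (by positivity) hM)
        (ENNReal.rpow_lt_top_of_nonneg hexp hAtop))
  have hcac := caccioppoli hlam hK hκ hκ' hsol.meas hsol.bound hsol.elliptic hsol.meas_c hsol.meas_g
    hsol.meas_c₁ hsol.meas_g₁ hβ hβ₁ hu hζ (hsol.ineq κ (by linarith) ζ hζ hζ0) hΨI
  have hR : ∫⁻ x, ENNReal.ofReal (max (u x - κ) 0 ^ 2 * ∑ i, pderiv i ζ x ^ 2) ∂(muB m)
      ≤ ENNReal.ofReal (L ^ 2) * W := by
    calc _ ≤ ∫⁻ x, ENNReal.ofReal (max (u x - κ) 0 ^ 2 * ∑ i, pderiv i ζ x ^ 2) ∂μ :=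
          lintegral_mono' (Measure.le_add_right le_rfl) le_rfl
      _ ≤ ∫⁻ x, ENNReal.ofReal (L ^ 2) *
            S.indicator (fun x => ‖max (u x - κ) 0‖ₑ ^ (2 : ℝ)) x ∂μ := by
          refine lintegral_mono fun x => ?_
          by_cases hx : x ∈ S
          · have h1 := hgrad x
            rw [indicator_of_mem hx] at h1
            rw [indicator_of_mem hx, Real.enorm_of_nonneg (le_max_right _ _)]
            rw [ENNReal.rpow_two, ← ENNReal.ofReal_pow (le_max_right _ _),
              ← ENNReal.ofReal_mul (sq_nonneg _), mul_comm (L ^ 2)]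
            exact ENNReal.ofReal_le_ofReal (mul_le_mul_of_nonneg_left h1 (sq_nonneg _))
          · have h1 := hgrad x
            rw [indicator_of_notMem hx] at h1
            have : ∑ i, pderiv i ζ x ^ 2 = 0 :=
              le_antisymm h1 (Finset.sum_nonneg fun i _ => sq_nonneg _)
            simp [this]
      _ = _ := by
          rw [lintegral_const_mul' _ _ ENNReal.ofReal_ne_top, lintegral_indicator hS]
  have hΨR : ∫⁻ x, ENNReal.ofReal (Ψ x) ∂μ ≤ ∫⁻ x, ‖Ψ x‖ₑ ∂μ := lintegral_mono fun x => by
    rw [Real.enorm_eq_ofReal_abs]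
    exact ENNReal.ofReal_le_ofReal (le_abs_self _)
  have hL1 : (1 : ℝ≥0∞) ≤ ENNReal.ofReal (L ^ 2) := by
    rw [ENNReal.one_le_ofReal]; exact one_le_pow₀ hL
  have hNfin : N ≤ 2 * (C2 * (1 + T + M ^ (1 / s)) * (ENNReal.ofReal (L ^ 2) * W +
      ENNReal.ofReal (K ^ 2) * A ^ (1 - 1 / s))) := by
    refine le_two_mul_of_le_add_mul hNtop ?_ hT
    calc N ≤ Cs ^ (2 : ℝ) * (((m + 2 : ℕ) : ℝ≥0∞) * (C1 * (ENNReal.ofReal (L ^ 2) * W +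
          (T * W + (T ^ (-(s - (m + 1))) * M) ^ (1 / ((m : ℝ) + 1)) * N +
        ENNReal.ofReal (K ^ 2) * (M ^ (1 / s) * A ^ (1 - 1 / s)))))) := by
          refine hNle.trans ?_
          gcongr
          refine hcac.trans ?_
          gcongr
          exact hΨR.trans hΨint
      _ = C2 * (ENNReal.ofReal (L ^ 2) * W + T * W +
            M ^ (1 / s) * (ENNReal.ofReal (K ^ 2) * A ^ (1 - 1 / s))) +
            C2 * (T ^ (-(s - (m + 1))) * M) ^ (1 / ((m : ℝ) + 1)) * N := by
          rw [hC2]; ring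
      _ ≤ _ := by
          refine add_le_add ?_ le_rfl
          rw [mul_assoc C2]
          refine mul_le_mul_right ?_ _
          set X := ENNReal.ofReal (L ^ 2) * W
          set Y := ENNReal.ofReal (K ^ 2) * A ^ (1 - 1 / s)
          have hX : T * W ≤ T * X := by
            gcongr
            exact le_mul_of_one_le_left zero_le hL1
          calc X + T * W + M ^ (1 / s) * Y ≤ X + T * X + M ^ (1 / s) * Y := by gcongr
            _ ≤ X + T * X + M ^ (1 / s) * Y + (M ^ (1 / s) * X + Y + T * Y) := le_self_add
            _ = _ := by ring
  have hFχ : ∀ x, F x ^ (2 : ℝ) = F x ^ (2 : ℝ) * χ x := by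
    intro x
    by_cases hx : x ∈ S
    · simp only [hχ, indicator_of_mem hx]
      split_ifs with h
      · rw [mul_one]
      · have : f x = 0 := by
          simp only [hf]
          rw [max_eq_right (by linarith), zero_mul]
        simp [hFdef, this]
    · simp [hFdef, hf, hζS x hx]
  -- The gain: F vanishes outside {u > κ} ∩ S, so passing from L² to L^r there yields a positive
  -- power of the measure A.
  have hlast : ∫⁻ x, F x ^ (2 : ℝ) ∂μ ≤ N * A ^ (1 / ((m : ℝ) + 1)) := by
    have hconj : Real.HolderConjugate (((m : ℝ) + 1) / m) ((m : ℝ) + 1) := by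
      rw [Real.holderConjugate_iff]
      refine ⟨by rw [lt_div_iff₀ (by linarith)]; linarith, ?_⟩
      field_simp
    calc ∫⁻ x, F x ^ (2 : ℝ) ∂μ = ∫⁻ x, F x ^ (2 : ℝ) * χ x ∂μ := lintegral_congr hFχ
      _ ≤ _ := ENNReal.lintegral_mul_le_Lp_mul_Lq μ hconj (hFm.pow_const _) hχm
      _ = _ := by
          simp only [hχp _ (by linarith : (0 : ℝ) < m + 1), hAχ, hN]
          congr 2
          · refine lintegral_congr fun x => ?_
            rw [← ENNReal.rpow_mul]
            congr 1
            rw [hrdef, traceExp]; ring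
          · rw [hrdef, traceExp]; field_simp
  refine hlast.trans ?_
  gcongr
  refine hNfin.trans (le_of_eq ?_)
  ring

/-! ### The nonlinear recursion and the nested cutoffs. -/

/-- Superlinear recursions started at a small value converge to `0`. -/
lemma exists_fast_convergence {C : ℝ≥0∞} (hC : C ≠ ⊤) {b δ : ℝ} (hb : 1 < b) (hδ : 0 < δ) :
    ∃ η : ℝ≥0∞, η ≠ 0 ∧ η ≠ ⊤ ∧ ∀ U : ℕ → ℝ≥0∞, U 0 ≤ η →
      (∀ j, U j ≤ 1 → U (j + 1) ≤ C * ENNReal.ofReal (b ^ j) * U j ^ (1 + δ)) →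
      Tendsto U atTop (𝓝 0) := by
  set B : ℝ≥0∞ := ENNReal.ofReal b with hB
  have hb0 : 0 < b := by linarith
  have hB0 : B ≠ 0 := by simp [hB, hb0]
  have hBtop : B ≠ ⊤ := ENNReal.ofReal_ne_top
  have hB1 : 1 < B := by rw [hB, ENNReal.one_lt_ofReal]; exact hb
  -- The ratio θ is fixed by b^j θ^(jδ) = 1, and η below by Cη^δ ≤ θ; then U j ≤ ηθ^j propagates by
  -- induction. As η ≤ 1, the condition U j ≤ 1 under which the recursion is available is never
  -- lost.
  set θ : ℝ≥0∞ := B ^ (-(1 / δ)) with hθ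
  have hθ1 : θ < 1 := ENNReal.rpow_lt_one_of_one_lt_of_neg hB1 (by
    have : 0 < 1 / δ := by positivity
    linarith)
  have hθ0 : θ ≠ 0 := by simp [hθ, ENNReal.rpow_eq_zero_iff, hB0, hBtop]
  have hθtop : θ ≠ ⊤ := hθ1.ne_top
  have hθδ : θ ^ δ = B⁻¹ := by
    rw [hθ, ← ENNReal.rpow_mul, neg_mul, one_div_mul_cancel hδ.ne', ENNReal.rpow_neg_one]
  have hC1 : C + 1 ≠ ⊤ := ENNReal.add_ne_top.2 ⟨hC, by norm_num⟩
  have hq0 : θ / (C + 1) ≠ 0 := ENNReal.div_ne_zero.2 ⟨hθ0, hC1⟩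
  have hqtop : θ / (C + 1) ≠ ⊤ := ENNReal.div_ne_top hθtop (by simp)
  have hq1 : θ / (C + 1) ≤ 1 := ENNReal.div_le_of_le_mul (by
    rw [one_mul]; exact hθ1.le.trans le_add_self)
  set η : ℝ≥0∞ := (θ / (C + 1)) ^ (1 / δ) with hη
  have hη0 : η ≠ 0 := by simp [hη, ENNReal.rpow_eq_zero_iff, hq0, hqtop]
  have hηtop : η ≠ ⊤ := ENNReal.rpow_ne_top_of_nonneg (by positivity) hqtop
  have hη1 : η ≤ 1 := ENNReal.rpow_le_one hq1 (by positivity)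
  have hηδ : C * η ^ δ ≤ θ := by
    rw [hη, ← ENNReal.rpow_mul, one_div_mul_cancel hδ.ne', ENNReal.rpow_one]
    calc C * (θ / (C + 1)) ≤ (C + 1) * (θ / (C + 1)) := by gcongr; exact le_self_add
      _ = θ := ENNReal.mul_div_cancel (by simp) hC1
  refine ⟨η, hη0, hηtop, fun U h0 hU => ?_⟩
  have key : ∀ j, U j ≤ η * θ ^ j := by
    intro j
    induction j with
    | zero => simpa using h0
    | succ j ih =>
      have hle1 : U j ≤ 1 := ih.trans (mul_le_one' hη1 (pow_le_one' hθ1.le j))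
      have e1 : ENNReal.ofReal (b ^ j) * (θ ^ j) ^ δ = 1 := by
        rw [ENNReal.ofReal_pow hb0.le, ← hB, ← ENNReal.rpow_natCast θ, ← ENNReal.rpow_mul,
          mul_comm (j : ℝ), ENNReal.rpow_mul, hθδ, ENNReal.rpow_natCast, ← mul_pow,
          ENNReal.mul_inv_cancel hB0 hBtop, one_pow]
      calc U (j + 1) ≤ C * ENNReal.ofReal (b ^ j) * U j ^ (1 + δ) := hU j hle1
        _ ≤ C * ENNReal.ofReal (b ^ j) * (η * θ ^ j) ^ (1 + δ) := by gcongr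
        _ = C * ENNReal.ofReal (b ^ j) * ((η * θ ^ j) * (η ^ δ * (θ ^ j) ^ δ)) := by
            rw [ENNReal.rpow_add_of_nonneg _ _ zero_le_one hδ.le, ENNReal.rpow_one,
              ENNReal.mul_rpow_of_nonneg _ _ hδ.le]
        _ = C * η ^ δ * (η * θ ^ j) * (ENNReal.ofReal (b ^ j) * (θ ^ j) ^ δ) := by ring
        _ = C * η ^ δ * (η * θ ^ j) := by rw [e1, mul_one]
        _ ≤ θ * (η * θ ^ j) := by gcongr
        _ = η * θ ^ (j + 1) := by ring
  have hlim : Tendsto (fun j => η * θ ^ j) atTop (𝓝 (η * 0)) :=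
    ENNReal.Tendsto.const_mul (ENNReal.tendsto_pow_atTop_nhds_zero_of_lt_one hθ1) (Or.inr hηtop)
  rw [mul_zero] at hlim
  exact tendsto_of_tendsto_of_tendsto_of_le_of_le tendsto_const_nhds hlim (fun _ => zero_le) key

lemma exists_bound_deriv_smoothTransition :
    ∃ M : ℝ, 0 ≤ M ∧ ∀ t, |deriv Real.smoothTransition t| ≤ M := by
  have hc : Continuous (deriv Real.smoothTransition) :=
    (Real.smoothTransition.contDiff (n := 1)).continuous_deriv (by simp)
  have hs : HasCompactSupport (deriv Real.smoothTransition) := by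
    refine HasCompactSupport.intro (isCompact_Icc (a := (0 : ℝ)) (b := 1)) fun x hx => ?_
    rw [Set.mem_Icc, not_and_or, not_le, not_le] at hx
    rcases hx with h | h
    · have : Real.smoothTransition =ᶠ[𝓝 x] fun _ => 0 := by
        filter_upwards [Iio_mem_nhds h] with y hy
        exact Real.smoothTransition.zero_of_nonpos (le_of_lt hy)
      rw [this.deriv_eq, deriv_const]
    · have : Real.smoothTransition =ᶠ[𝓝 x] fun _ => 1 := by
        filter_upwards [Ioi_mem_nhds h] with y hy
        exact Real.smoothTransition.one_of_one_le (le_of_lt hy)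
      rw [this.deriv_eq, deriv_const]
  obtain ⟨M, hM⟩ := hs.exists_bound_of_continuous hc
  exact ⟨M, (norm_nonneg _).trans (hM 0), hM⟩

/-- A smooth cutoff function that equals `1` on a given compact set. -/
lemma exists_cutoff {m : ℕ} {U X : Set (Space m)} (hU : IsOpen U) (hX : IsCompact X)
    (hXU : X ⊆ U) : ∃ ψ : Space m → ℝ, IsTestFunction U ψ ∧ ∀ x ∈ X, ψ x = 1 := by
  obtain ⟨V, hV, hXV, hVU⟩ := exists_compact_between hX hU hXU
  obtain ⟨ψ, h1, -, h3, h4⟩ := exists_contMDiff_support_eq_eq_one_iff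
    (modelWithCornersSelf ℝ (Space m)) isOpen_interior hX.isClosed hXV
  have hts : tsupport ψ ⊆ V := closure_minimal (h3.subset.trans interior_subset) hV.isClosed
  exact ⟨ψ, ⟨h1.contDiff, HasCompactSupport.of_support_subset_isCompact hV
    ((subset_tsupport _).trans hts), hts.trans hVU⟩, fun x hx => (h4 x).1 hx⟩

/-- The nested cutoff functions of De Giorgi's iteration. -/
def stepCutoff {m : ℕ} (ψ : Space m → ℝ) (j : ℕ) (x : Space m) : ℝ :=
  Real.smoothTransition ((ψ x - (1 - (1 / 2) ^ (j + 1))) * 2 ^ (j + 2))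

/-- The nested sets of De Giorgi's iteration. -/
def stepSet {m : ℕ} (ψ : Space m → ℝ) (j : ℕ) : Set (Space m) :=
  {x | 1 - (1 / 2) ^ (j + 1) ≤ ψ x}

lemma stepCutoff_eq_zero {m : ℕ} {ψ : Space m → ℝ} {j : ℕ} {x : Space m} (hx : x ∉ stepSet ψ j) :
    stepCutoff ψ j x = 0 := by
  have h : ψ x < 1 - (1 / 2) ^ (j + 1) := not_le.1 hx
  refine Real.smoothTransition.zero_of_nonpos ?_
  exact mul_nonpos_of_nonpos_of_nonneg (by linarith) (by positivity)

/-- Consecutive thresholds 1 - 2^(-(j+1)) and 1 - 2^(-(j+2)) differ by 2^(-(j+2)), which the factor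
in `stepCutoff` rescales to 1. -/
lemma stepCutoff_eq_one {m : ℕ} {ψ : Space m → ℝ} {j : ℕ} {x : Space m}
    (hx : x ∈ stepSet ψ (j + 1)) : stepCutoff ψ j x = 1 := by
  have h : 1 - (1 / 2) ^ (j + 1 + 1) ≤ ψ x := hx
  refine Real.smoothTransition.one_of_one_le ?_
  have e : ((1 : ℝ) / 2) ^ (j + 2) * 2 ^ (j + 2) = 1 := by rw [← mul_pow]; norm_num
  have h2 : ((1 : ℝ) / 2) ^ (j + 2) ≤ ψ x - (1 - (1 / 2) ^ (j + 1)) := by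
    have : ((1 : ℝ) / 2) ^ (j + 1) = 2 * (1 / 2) ^ (j + 2) := by ring
    have h' : 1 - ((1 : ℝ) / 2) ^ (j + 2) ≤ ψ x := h
    linarith
  calc (1 : ℝ) = (1 / 2) ^ (j + 2) * 2 ^ (j + 2) := e.symm
    _ ≤ _ := mul_le_mul_of_nonneg_right h2 (by positivity)

/-- All thresholds are at least 1/2, so the cutoff vanishes wherever ψ does and inherits its
support. -/
lemma isTestFunction_stepCutoff {m : ℕ} {U : Set (Space m)} {ψ : Space m → ℝ}
    (hψ : IsTestFunction U ψ) (j : ℕ) : IsTestFunction U (stepCutoff ψ j) := by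
  have hsub : tsupport (stepCutoff ψ j) ⊆ tsupport ψ := by
    refine closure_mono fun x hx => ?_
    by_contra h
    have h0 : ψ x = 0 := by simpa using h
    refine hx (stepCutoff_eq_zero fun hx' => ?_)
    have h1 : 1 - ((1 : ℝ) / 2) ^ (j + 1) ≤ ψ x := hx'
    have h2 : ((1 : ℝ) / 2) ^ (j + 1) < 1 := pow_lt_one₀ (by norm_num) (by norm_num) (by omega)
    linarith
  refine ⟨?_, hψ.compact.mono' (subset_closure.trans hsub), hsub.trans hψ.support_subset⟩
  exact Real.smoothTransition.contDiff.comp ((hψ.smooth.sub contDiff_const).mul contDiff_const)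

/-- The slope 2^(j+2) = 4·2^j makes the gradient grow like 2^j, and outside `stepSet ψ j` the
argument of the transition is negative, where its derivative vanishes. -/
lemma exists_gradient_bound {m : ℕ} {U : Set (Space m)} {ψ : Space m → ℝ}
    (hψ : IsTestFunction U ψ) : ∃ L : ℝ, 1 ≤ L ∧ ∀ j x,
      ∑ i, pderiv i (stepCutoff ψ j) x ^ 2 ≤ (stepSet ψ j).indicator (fun _ => (L * 2 ^ j) ^ 2) x := by
  obtain ⟨M₁, hM₁, h1⟩ := exists_bound_deriv_smoothTransition
  obtain ⟨M₂, hM₂, -, h2⟩ := hψ.exists_bound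
  refine ⟨1 + ((m : ℝ) + 2) * (M₁ * 4 * M₂), le_add_of_nonneg_right (by positivity), fun j x => ?_⟩
  have hd : ∀ i, pderiv i (stepCutoff ψ j) x =
      deriv Real.smoothTransition ((ψ x - (1 - (1 / 2) ^ (j + 1))) * 2 ^ (j + 2)) *
        (2 ^ (j + 2) * pderiv i ψ x) := by
    intro i
    have e1 : HasFDerivAt (fun x => (ψ x - (1 - (1 / 2) ^ (j + 1))) * (2 : ℝ) ^ (j + 2))
        ((2 : ℝ) ^ (j + 2) • fderiv ℝ ψ x) x :=
      (((hψ.smooth.differentiable (by simp)) x).hasFDerivAt.sub_const _).mul_const _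
    have e2 : HasDerivAt Real.smoothTransition _ ((ψ x - (1 - (1 / 2) ^ (j + 1))) * 2 ^ (j + 2)) :=
      ((Real.smoothTransition.contDiff (n := 1)).differentiable (by simp) _).hasDerivAt
    have e3 := e2.comp_hasFDerivAt x e1
    have e4 : fderiv ℝ (stepCutoff ψ j) x = _ := e3.fderiv
    rw [pderiv, e4]
    simp [pderiv]
  by_cases hx : x ∈ stepSet ψ j
  · rw [indicator_of_mem hx]
    have h3 : ∀ i, pderiv i (stepCutoff ψ j) x ^ 2 ≤ (M₁ * 4 * M₂ * 2 ^ j) ^ 2 := by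
      intro i
      rw [← sq_abs]
      refine pow_le_pow_left₀ (abs_nonneg _) ?_ 2
      rw [hd i, abs_mul, abs_mul, abs_of_pos (by positivity : (0 : ℝ) < 2 ^ (j + 2))]
      calc _ ≤ M₁ * (2 ^ (j + 2) * M₂) := by
            gcongr
            · exact h1 _
            · exact h2 i x
        _ = _ := by ring
    calc ∑ i, pderiv i (stepCutoff ψ j) x ^ 2 ≤ ∑ _i : Fin (m + 2), (M₁ * 4 * M₂ * 2 ^ j) ^ 2 :=
          Finset.sum_le_sum fun i _ => h3 i
      _ = ((m : ℝ) + 2) * (M₁ * 4 * M₂ * 2 ^ j) ^ 2 := by simp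
      _ ≤ ((m : ℝ) + 2) ^ 2 * (M₁ * 4 * M₂ * 2 ^ j) ^ 2 := by
          gcongr
          nlinarith [(Nat.cast_nonneg m : (0 : ℝ) ≤ m)]
      _ = (((m : ℝ) + 2) * (M₁ * 4 * M₂) * 2 ^ j) ^ 2 := by ring
      _ ≤ _ := by
          gcongr
          linarith
  · rw [indicator_of_notMem hx]
    have h : ψ x < 1 - (1 / 2) ^ (j + 1) := not_le.1 hx
    have hneg : (ψ x - (1 - (1 / 2) ^ (j + 1))) * 2 ^ (j + 2) < 0 :=
      mul_neg_of_neg_of_pos (by linarith) (by positivity)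
    have h0 : deriv Real.smoothTransition ((ψ x - (1 - (1 / 2) ^ (j + 1))) * 2 ^ (j + 2)) = 0 := by
      have : Real.smoothTransition =ᶠ[𝓝 ((ψ x - (1 - (1 / 2) ^ (j + 1))) * 2 ^ (j + 2))]
          fun _ => 0 := by
        filter_upwards [Iio_mem_nhds hneg] with y hy
        exact Real.smoothTransition.zero_of_nonpos (le_of_lt hy)
      rw [this.deriv_eq, deriv_const]
    simp only [hd, h0, zero_mul]
    simp

/-! ### The iteration. -/

/-- De Giorgi's iteration: subsolutions with small positive part are bounded. -/
lemma exists_smallness_const {m : ℕ} (hm : 1 ≤ m) {lam : ℝ} (hlam : 0 < lam) (Lam : ℝ) {s : ℝ}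
    (hs : (m : ℝ) + 1 < s) {M : ℝ≥0∞} (hM : M ≠ ⊤) {X : Set (Space m)} (hX : IsCompact X)
    (hXU : X ⊆ cubeTop m) :
    ∃ η : ℝ≥0∞, η ≠ 0 ∧ η ≠ ⊤ ∧ ∀ (a : Fin (m + 2) → Fin (m + 2) → Space m → ℝ)
      (c c₁ g g₁ u : Space m → ℝ), IsSubsolution lam Lam a c c₁ g g₁ u →
      ∀ (K : ℝ) (β : Space m → ℝ), 0 < K → AEStronglyMeasurable β (muBN m) →
      (∀ᵐ x ∂(muB m), |c x| + |g x| / K ≤ β x) →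
      (∀ᵐ x ∂(sigmaN m), |c₁ x| + |g₁ x| / K ≤ β x) →
      ∫⁻ x, ‖β x‖ₑ ^ s ∂(muBN m) ≤ M →
      eLpNorm u⁺ 2 (muBN m) ^ (2 : ℝ) ≤ η * ENNReal.ofReal (K ^ 2) →
      eLpNorm u⁺ ⊤ ((muBN m).restrict X) ≤ ENNReal.ofReal (2 * K) := by
  have hm' : (1 : ℝ) ≤ m := by exact_mod_cast hm
  have hs0 : 0 < s := by linarith
  obtain ⟨C, hC, hstep⟩ := exists_iteration_const hm hlam Lam hs hM
  obtain ⟨ψ, hψ, hψX⟩ := exists_cutoff (isOpen_cubeTop m) hX hXU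
  obtain ⟨L, hL, hgrad⟩ := exists_gradient_bound hψ
  -- The superlinearity of the recursion; it is exactly the condition s > n - 1.
  have hδ : 0 < 1 / ((m : ℝ) + 1) - 1 / s := by
    rw [sub_pos]
    exact one_div_lt_one_div_of_lt (by linarith) hs
  set δ := 1 / ((m : ℝ) + 1) - 1 / s with hδdef
  have hC' : C * ENNReal.ofReal (4 * L ^ 2 + 16) ≠ ⊤ :=
    ENNReal.mul_ne_top hC ENNReal.ofReal_ne_top
  -- The base 16 is 4·4: one 4^j from the squared gradient of the cutoff or from the measure of the
  -- superlevel set, another from the second power of that measure. Precisely, (L²4^j +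
  -- 4^(j+1))·4^(j+1) = (4L² + 16)·16^j.
  obtain ⟨η, hη0, hηtop, hfast⟩ := exists_fast_convergence hC' (by norm_num : (1 : ℝ) < 16) hδ
  refine ⟨η, hη0, hηtop, ?_⟩
  intro a c c₁ g g₁ u hsol K β hK hβm hβ hβ₁ hβs hsmall
  have hu := hsol.hasH1Trace
  set μ := muBN m with hμ
  set κ : ℕ → ℝ := fun j => K * (2 - (1 / 2) ^ j) with hκ
  have hpow : ∀ j : ℕ, 0 < ((1 : ℝ) / 2) ^ j ∧ ((1 : ℝ) / 2) ^ j ≤ 1 := fun j =>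
    ⟨by positivity, pow_le_one₀ (by norm_num) (by norm_num)⟩
  have hκ1 : ∀ j, K ≤ κ j := fun j => by
    simp only [hκ]; nlinarith [hpow j]
  have hκ2 : ∀ j, κ j ≤ 2 * K := fun j => by
    simp only [hκ]; nlinarith [hpow j]
  have hκ3 : ∀ j, κ (j + 1) - κ j = K * (1 / 2) ^ (j + 1) := fun j => by
    simp only [hκ]; ring
  have hSm : ∀ j, MeasurableSet (stepSet ψ j) := fun j =>
    (isClosed_le continuous_const hψ.smooth.continuous).measurableSet
  set W : ℕ → ℝ≥0∞ := fun j => ∫⁻ x in stepSet ψ j, ‖max (u x - κ j) 0‖ₑ ^ (2 : ℝ) ∂μ with hW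
  have hKpos : 0 < K ^ 2 := by positivity
  set k2 : ℝ≥0∞ := ENNReal.ofReal (K ^ 2) with hk2
  have hk20 : k2 ≠ 0 := by simp [hk2, hK.ne']
  have hk2top : k2 ≠ ⊤ := ENNReal.ofReal_ne_top
  have hrec : ∀ j, W j / k2 ≤ 1 → W (j + 1) / k2 ≤
      C * ENNReal.ofReal (4 * L ^ 2 + 16) * ENNReal.ofReal (16 ^ j) * (W j / k2) ^ (1 + δ) := by
    intro j hj
    set V : ℝ≥0∞ := W j / k2 with hV
    have hWV : W j = k2 * V := (ENNReal.mul_div_cancel hk20 hk2top).symm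
    set A : ℝ≥0∞ := ∫⁻ x in stepSet ψ j, (if κ (j + 1) < u x then 1 else 0) ∂μ with hA
    have hWle : ∫⁻ x in stepSet ψ j, ‖max (u x - κ (j + 1)) 0‖ₑ ^ (2 : ℝ) ∂μ ≤ W j := by
      refine lintegral_mono fun x => ENNReal.rpow_le_rpow ?_ (by norm_num)
      refine enorm_le_iff_norm_le.2 ?_
      rw [Real.norm_of_nonneg (le_max_right _ _), Real.norm_of_nonneg (le_max_right _ _)]
      refine max_le_max ?_ le_rfl
      have := hκ3 j
      have : 0 ≤ K * (1 / 2) ^ (j + 1) := by positivity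
      linarith
    set q : ℝ≥0∞ := ENNReal.ofReal (4 ^ (j + 1)) with hq
    -- Chebyshev's inequality: on {u > κ (j+1)} the truncation at level κ j is at least the gap
    -- K·2^(-(j+1)) between the levels.
    have hAV : A ≤ q * V := by
      have h1 : k2 * A ≤ q * W j := by
        rw [hA, hW, ← lintegral_const_mul' _ _ hk2top, ← lintegral_const_mul' _ _ ENNReal.ofReal_ne_top]
        refine lintegral_mono fun x => ?_
        split_ifs with h
        · rw [mul_one, ENNReal.rpow_two, Real.enorm_of_nonneg (le_max_right _ _),
            ← ENNReal.ofReal_pow (le_max_right _ _), ← ENNReal.ofReal_mul (by positivity)]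
          refine ENNReal.ofReal_le_ofReal ?_
          have h2 : K * (1 / 2) ^ (j + 1) ≤ max (u x - κ j) 0 := by
            refine le_max_of_le_left ?_
            rw [← hκ3 j]; linarith
          calc K ^ 2 = 4 ^ (j + 1) * (K * (1 / 2) ^ (j + 1)) ^ 2 := by
                rw [mul_pow, ← pow_mul, mul_comm (j + 1) 2, pow_mul, mul_left_comm, ← mul_pow]
                norm_num
            _ ≤ _ := by gcongr
        · simp
      rw [hWV, mul_left_comm] at h1
      exact (ENNReal.mul_le_mul_iff_right hk20 hk2top).1 h1
    have hq1 : 1 ≤ q := by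
      rw [hq, ENNReal.one_le_ofReal]; exact one_le_pow₀ (by norm_num)
    have h1 := hstep a c c₁ g g₁ u hsol K β hK hβm hβ hβ₁ hβs (κ (j + 1)) (stepCutoff ψ j)
      (stepSet ψ j) (L * 2 ^ j) (hκ1 _) (hκ2 _) (isTestFunction_stepCutoff hψ j)
      (fun x => Real.smoothTransition.nonneg _) (fun x => Real.smoothTransition.le_one _) (hSm j)
      (fun x hx => stepCutoff_eq_zero hx)
      (by
        have : (1 : ℝ) ≤ 2 ^ j := one_le_pow₀ (by norm_num)
        nlinarith) (hgrad j)
    have h2 : W (j + 1) ≤ ∫⁻ x, ‖max (u x - κ (j + 1)) 0 * stepCutoff ψ j x‖ₑ ^ (2 : ℝ) ∂μ := by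
      simp only [hW]
      rw [← lintegral_indicator (hSm (j + 1))]
      refine lintegral_mono fun x => ?_
      by_cases hx : x ∈ stepSet ψ (j + 1)
      · rw [indicator_of_mem hx, stepCutoff_eq_one hx, mul_one]
      · rw [indicator_of_notMem hx]; exact zero_le
    have hexp : 0 ≤ 1 - 1 / s := by
      rw [sub_nonneg, div_le_one hs0]; linarith
    have hexp2 : 0 ≤ 1 / ((m : ℝ) + 1) := by positivity
    have hA1 : A ^ (1 - 1 / s) ≤ q * V ^ (1 - 1 / s) := by
      calc A ^ (1 - 1 / s) ≤ (q * V) ^ (1 - 1 / s) := by gcongr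
        _ = q ^ (1 - 1 / s) * V ^ (1 - 1 / s) := ENNReal.mul_rpow_of_nonneg _ _ hexp
        _ ≤ q ^ (1 : ℝ) * V ^ (1 - 1 / s) := by
            have : 0 ≤ 1 / s := by positivity
            gcongr
            linarith
        _ = _ := by rw [ENNReal.rpow_one]
    have hA2 : A ^ (1 / ((m : ℝ) + 1)) ≤ q * V ^ (1 / ((m : ℝ) + 1)) := by
      calc A ^ (1 / ((m : ℝ) + 1)) ≤ (q * V) ^ (1 / ((m : ℝ) + 1)) := by gcongr
        _ = q ^ (1 / ((m : ℝ) + 1)) * V ^ (1 / ((m : ℝ) + 1)) :=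
            ENNReal.mul_rpow_of_nonneg _ _ hexp2
        _ ≤ q ^ (1 : ℝ) * V ^ (1 / ((m : ℝ) + 1)) := by
            gcongr
            rw [div_le_one (by linarith)]; linarith
        _ = _ := by rw [ENNReal.rpow_one]
    -- Here V ≤ 1 is used, to bring the gradient term to the same power as the data term.
    have hV1 : V ≤ V ^ (1 - 1 / s) := by
      calc V = V ^ (1 : ℝ) := (ENNReal.rpow_one V).symm
        _ ≤ _ := ENNReal.rpow_le_rpow_of_exponent_ge hj (by
          have : 0 ≤ 1 / s := by positivity
          linarith)
    refine ENNReal.div_le_of_le_mul ?_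
    calc W (j + 1) ≤ C * (ENNReal.ofReal ((L * 2 ^ j) ^ 2) * (k2 * V) +
          k2 * A ^ (1 - 1 / s)) * A ^ (1 / ((m : ℝ) + 1)) := by
          refine h2.trans (h1.trans ?_)
          rw [← hWV]
          gcongr
      _ ≤ C * (ENNReal.ofReal ((L * 2 ^ j) ^ 2) * (k2 * V ^ (1 - 1 / s)) +
          k2 * (q * V ^ (1 - 1 / s))) * (q * V ^ (1 / ((m : ℝ) + 1))) := by gcongr
      _ = C * ((ENNReal.ofReal ((L * 2 ^ j) ^ 2) + q) * q) *
            (V ^ (1 - 1 / s) * V ^ (1 / ((m : ℝ) + 1))) * k2 := by ring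
      _ = _ := by
          congr 1
          rw [← ENNReal.rpow_add_of_nonneg _ _ hexp hexp2]
          have e1 : 1 - 1 / s + 1 / ((m : ℝ) + 1) = 1 + δ := by rw [hδdef]; ring
          have e2 : (ENNReal.ofReal ((L * 2 ^ j) ^ 2) + q) * q
              = ENNReal.ofReal (4 * L ^ 2 + 16) * ENNReal.ofReal (16 ^ j) := by
            rw [hq, ← ENNReal.ofReal_add (by positivity) (by positivity),
              ← ENNReal.ofReal_mul (by positivity), ← ENNReal.ofReal_mul (by positivity)]
            congr 1
            have e3 : (2 ^ j : ℝ) ^ 2 = 4 ^ j := by rw [← pow_mul, mul_comm, pow_mul]; norm_num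
            have e4 : (16 : ℝ) ^ j = 4 ^ j * 4 ^ j := by rw [← mul_pow]; norm_num
            rw [mul_pow, e3, e4]
            ring
          rw [e1, e2]
          ring
  have hW0 : W 0 / k2 ≤ η := by
    refine ENNReal.div_le_of_le_mul (le_trans ?_ hsmall)
    rw [eLpNorm_eq_lintegral_rpow_enorm_toReal (by norm_num) (by norm_num), ← ENNReal.rpow_mul]
    simp only [ENNReal.toReal_ofNat, one_div, inv_mul_cancel₀ (two_ne_zero (α := ℝ)),
      ENNReal.rpow_one]
    refine (lintegral_mono' Measure.restrict_le_self le_rfl).trans (lintegral_mono fun x => ?_)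
    refine ENNReal.rpow_le_rpow (enorm_le_iff_norm_le.2 ?_) (by norm_num)
    rw [Real.norm_of_nonneg (le_max_right _ _), Pi.posPart_apply, posPart_def,
      Real.norm_of_nonneg le_sup_right]
    refine max_le_max ?_ le_rfl
    linarith [hκ1 0]
  have hlim := hfast (fun j => W j / k2) hW0 hrec
  have hXS : ∀ j, X ⊆ stepSet ψ j := fun j x hx => by
    change 1 - (1 / 2) ^ (j + 1) ≤ ψ x
    rw [hψX x hx]
    linarith [(hpow (j + 1)).1]
  -- Since ψ = 1 on X and every level is at most 2K, this integral is bounded by each W j, and these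
  -- tend to 0.
  have hzero : ∫⁻ x in X, ‖max (u x - 2 * K) 0‖ₑ ^ (2 : ℝ) ∂μ = 0 := by
    have hle : ∀ j, (∫⁻ x in X, ‖max (u x - 2 * K) 0‖ₑ ^ (2 : ℝ) ∂μ) / k2 ≤ W j / k2 := by
      intro j
      refine ENNReal.div_le_div_right ?_ _
      refine (lintegral_mono_set (hXS j)).trans (lintegral_mono fun x => ?_)
      refine ENNReal.rpow_le_rpow (enorm_le_iff_norm_le.2 ?_) (by norm_num)
      rw [Real.norm_of_nonneg (le_max_right _ _), Real.norm_of_nonneg (le_max_right _ _)]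
      exact max_le_max (by linarith [hκ2 j]) le_rfl
    have h0 := le_antisymm (ge_of_tendsto' hlim hle) zero_le
    rcases ENNReal.div_eq_zero_iff.1 h0 with h | h
    · exact h
    · exact absurd h hk2top
  have hmeas : AEMeasurable (fun x => ‖max (u x - 2 * K) 0‖ₑ ^ (2 : ℝ)) (μ.restrict X) := by
    have h1 : AEStronglyMeasurable (fun x => u x - 2 * K) μ :=
      hu.memLp.1.sub aestronglyMeasurable_const
    have h2 : AEStronglyMeasurable (fun x => max (u x - 2 * K) 0) μ :=
      (by fun_prop : Continuous fun t : ℝ => max t 0).comp_aestronglyMeasurable h1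
    exact (h2.enorm.pow_const _).restrict
  rw [lintegral_eq_zero_iff' hmeas] at hzero
  rw [eLpNorm_exponent_top]
  refine eLpNormEssSup_le_of_ae_bound ?_
  filter_upwards [hzero] with x hx
  have h1 : max (u x - 2 * K) 0 = 0 := by
    have : ‖max (u x - 2 * K) 0‖ₑ = 0 := by
      by_contra h
      have hx' : ‖max (u x - 2 * K) 0‖ₑ ^ (2 : ℝ) = 0 := hx
      rw [ENNReal.rpow_eq_zero_iff] at hx'
      rcases hx' with h' | h'
      · exact h h'.1
      · linarith [h'.2]
    exact enorm_eq_zero.1 this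
  have h2 : u x ≤ 2 * K := by
    have := le_max_left (u x - 2 * K) 0
    linarith
  rw [Pi.posPart_apply, posPart_def, Real.norm_of_nonneg le_sup_right]
  exact max_le h2 (by linarith)

/-! ### Normalisation of the data and the bound at level K. -/

lemma exists_eLpNorm_le_mul {α : Type*} [MeasurableSpace α] (ν : Measure α) [IsFiniteMeasure ν]
    {p q : ℝ≥0∞} (hp : p ≠ 0) (hpq : p ≤ q) :
    ∃ V : ℝ≥0∞, V ≠ ⊤ ∧ ∀ f : α → ℝ, AEStronglyMeasurable f ν →
      eLpNorm f p ν ≤ V * eLpNorm f q ν := by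
  refine ⟨ν univ ^ (1 / p.toReal - 1 / q.toReal), ?_, fun f hf => ?_⟩
  · refine ENNReal.rpow_ne_top_of_nonneg ?_ (measure_ne_top _ _)
    rcases eq_or_ne q ⊤ with rfl | hq
    · simp
    · rw [sub_nonneg]
      exact one_div_le_one_div_of_le (ENNReal.toReal_pos hp (hpq.trans_lt hq.lt_top).ne)
        (ENNReal.toReal_mono hq hpq)
  · rw [mul_comm]
    exact eLpNorm_le_eLpNorm_mul_rpow_measure_univ hpq hf

/-- Because K dominates ‖g‖, the quotient g/K has norm at most 1 and the resulting bound involves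
neither g nor K. -/
lemma lintegral_coeff_le {α : Type*} [MeasurableSpace α] {ν : Measure α} {q V Λ : ℝ≥0∞}
    {s K : ℝ} {c g : α → ℝ} (hs : 0 < s) (hq : 1 ≤ q) (hK : 0 < K)
    (hV : ∀ f : α → ℝ, AEStronglyMeasurable f ν →
      eLpNorm f (ENNReal.ofReal s) ν ≤ V * eLpNorm f q ν)
    (hc : AEStronglyMeasurable c ν) (hg : AEStronglyMeasurable g ν)
    (hcΛ : eLpNorm c q ν ≤ Λ) (hgK : eLpNorm g q ν ≤ ENNReal.ofReal K) :
    ∫⁻ x, ‖|c x| + |g x| / K‖ₑ ^ s ∂ν ≤ (V * (Λ + 1)) ^ s := by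
  have hc' : AEStronglyMeasurable (fun x => |c x|) ν := hc.norm
  have hg' : AEStronglyMeasurable (K⁻¹ • fun x => |g x|) ν := hg.norm.const_smul _
  have e : (fun x => |c x| + |g x| / K) = (fun x => |c x|) + K⁻¹ • fun x => |g x| := by
    funext x
    simp [div_eq_inv_mul]
  have h1 : eLpNorm (fun x => |c x| + |g x| / K) q ν ≤ Λ + 1 := by
    rw [e]
    refine (eLpNorm_add_le hc' hg' hq).trans (add_le_add ?_ ?_)
    · exact (eLpNorm_norm c).trans_le hcΛ
    · rw [eLpNorm_const_smul, Real.enorm_of_nonneg (by positivity)]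
      calc ENNReal.ofReal K⁻¹ * eLpNorm (fun x => |g x|) q ν
          ≤ ENNReal.ofReal K⁻¹ * ENNReal.ofReal K := by
            gcongr
            exact (eLpNorm_norm g).trans_le hgK
        _ = 1 := by
            rw [← ENNReal.ofReal_mul (by positivity), inv_mul_cancel₀ hK.ne', ENNReal.ofReal_one]
  have h2 : eLpNorm (fun x => |c x| + |g x| / K) (ENNReal.ofReal s) ν ≤ V * (Λ + 1) := by
    refine (hV _ ?_).trans (by gcongr)
    rw [e]; exact hc'.add hg'
  rw [eLpNorm_eq_lintegral_rpow_enorm_toReal (by simpa using hs) ENNReal.ofReal_ne_top,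
    ENNReal.toReal_ofReal hs.le] at h2
  have h3 := ENNReal.rpow_le_rpow h2 hs.le
  rwa [← ENNReal.rpow_mul, one_div_mul_cancel hs.ne', ENNReal.rpow_one] at h3

/-- The local maximum principle at a level `K` that dominates the data. -/
lemma exists_sup_bound {m : ℕ} (hm : 1 ≤ m) {lam : ℝ} (hlam : 0 < lam) (Lam : ℝ)
    {q q₁ : ℝ≥0∞} (hq : (m : ℝ≥0∞) + 1 < q) (hq₁ : (m : ℝ≥0∞) + 1 < q₁)
    {X : Set (Space m)} (hX : IsCompact X) (hXU : X ⊆ cubeTop m) :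
    ∃ η : ℝ≥0∞, η ≠ 0 ∧ η ≠ ⊤ ∧ ∀ (a : Fin (m + 2) → Fin (m + 2) → Space m → ℝ)
      (c c₁ g g₁ u : Space m → ℝ), IsSubsolution lam Lam a c c₁ g g₁ u →
      eLpNorm c q (muB m) ≤ ENNReal.ofReal Lam →
      eLpNorm c₁ q₁ (sigmaN m) ≤ ENNReal.ofReal Lam →
      ∀ K : ℝ, 0 < K → eLpNorm g q (muB m) ≤ ENNReal.ofReal K →
      eLpNorm g₁ q₁ (sigmaN m) ≤ ENNReal.ofReal K →
      eLpNorm u⁺ 2 (muBN m) ≤ η * ENNReal.ofReal K →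
      eLpNorm u⁺ ⊤ ((muBN m).restrict X) ≤ ENNReal.ofReal (2 * K) := by
  classical
  -- Both q and q₁ may be ∞; the cap m + 2 produces one finite exponent still above m + 1 = n - 1.
  set t : ℝ≥0∞ := min (min q q₁) ((m : ℝ≥0∞) + 2) with ht
  have hmt : (m : ℝ≥0∞) + 2 ≠ ⊤ := by finiteness
  have httop : t ≠ ⊤ := ((min_le_right _ _).trans_lt hmt.lt_top).ne
  have hlt : (m : ℝ≥0∞) + 1 < t := by
    refine lt_min (lt_min hq hq₁) ?_
    exact_mod_cast (by omega : m + 1 < m + 2)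
  have hs : (m : ℝ) + 1 < t.toReal := by
    have h := (ENNReal.toReal_lt_toReal (by finiteness) httop).2 hlt
    rw [ENNReal.toReal_add (by finiteness) (by finiteness)] at h
    simpa using h
  set s := t.toReal with hsdef
  have hs0 : 0 < s := by linarith [(Nat.cast_nonneg m : (0 : ℝ) ≤ m)]
  have hst : ENNReal.ofReal s = t := ENNReal.ofReal_toReal httop
  have ht0 : t ≠ 0 := (lt_of_le_of_lt zero_le hlt).ne'
  have hone : ∀ {z : ℝ≥0∞}, (m : ℝ≥0∞) + 1 < z → 1 ≤ z := fun h => le_add_self.trans h.le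
  obtain ⟨V, hV, hVle⟩ := exists_eLpNorm_le_mul (muB m) ht0
    ((min_le_left _ _).trans (min_le_left q q₁) : t ≤ q)
  obtain ⟨V₁, hV₁, hVle₁⟩ := exists_eLpNorm_le_mul (sigmaN m) ht0
    ((min_le_left _ _).trans (min_le_right q q₁) : t ≤ q₁)
  rw [← hst] at hVle hVle₁
  set M : ℝ≥0∞ := (V * (ENNReal.ofReal Lam + 1)) ^ s + (V₁ * (ENNReal.ofReal Lam + 1)) ^ s with hM
  have hMtop : M ≠ ⊤ := by
    refine ENNReal.add_ne_top.2 ⟨?_, ?_⟩ <;>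
    exact ENNReal.rpow_ne_top_of_nonneg hs0.le (by finiteness)
  obtain ⟨η, hη0, hηtop, h⟩ := exists_smallness_const hm hlam Lam hs hMtop hX hXU
  -- The square root appears because the earlier smallness condition is on the square of the L²
  -- norm.
  refine ⟨η ^ (1 / 2 : ℝ), by simp [hη0], ENNReal.rpow_ne_top_of_nonneg (by norm_num) hηtop, ?_⟩
  intro a c c₁ g g₁ u hsol hc hc₁ K hK hg hg₁ hu
  -- B and N are disjoint, so one function can carry the interior and the boundary coefficients.
  set β : Space m → ℝ := fun x =>
    if x ∈ domB m then |c x| + |g x| / K else |c₁ x| + |g₁ x| / K with hβ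
  have hβB : β =ᵐ[muB m] fun x => |c x| + |g x| / K := by
    filter_upwards [ae_restrict_mem (measurableSet_domB m)] with x hx
    simp only [hβ, if_pos hx]
  have hβN : β =ᵐ[sigmaN m] fun x => |c₁ x| + |g₁ x| / K := by
    filter_upwards [ae_restrict_mem (measurableSet_faceN m)] with x hx
    simp only [hβ, if_neg (Set.disjoint_right.1 (disjoint_domB_faceN m) hx)]
  have hmB : AEStronglyMeasurable (fun x => |c x| + |g x| / K) (muB m) :=
    hsol.meas_c.norm.add (hsol.meas_g.norm.mul_const K⁻¹)
  have hmN : AEStronglyMeasurable (fun x => |c₁ x| + |g₁ x| / K) (sigmaN m) :=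
    hsol.meas_c₁.norm.add (hsol.meas_g₁.norm.mul_const K⁻¹)
  refine h a c c₁ g g₁ u hsol K β hK ((hmB.congr hβB.symm).add_measure (hmN.congr hβN.symm))
    hβB.symm.le hβN.symm.le ?_ ?_
  · rw [muBN, lintegral_add_measure]
    refine add_le_add ?_ ?_
    · have e : (fun x => ‖β x‖ₑ ^ s) =ᵐ[muB m] fun x => ‖|c x| + |g x| / K‖ₑ ^ s :=
        hβB.mono fun x hx => by simp only [hx]
      rw [lintegral_congr_ae e]
      exact lintegral_coeff_le hs0 (hone hq) hK hVle hsol.meas_c hsol.meas_g hc hg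
    · have e : (fun x => ‖β x‖ₑ ^ s) =ᵐ[sigmaN m] fun x => ‖|c₁ x| + |g₁ x| / K‖ₑ ^ s :=
        hβN.mono fun x hx => by simp only [hx]
      rw [lintegral_congr_ae e]
      exact lintegral_coeff_le hs0 (hone hq₁) hK hVle₁ hsol.meas_c₁ hsol.meas_g₁ hc₁ hg₁
  · refine (ENNReal.rpow_le_rpow hu (by norm_num)).trans (le_of_eq ?_)
    rw [ENNReal.mul_rpow_of_nonneg _ _ (by norm_num), ← ENNReal.rpow_mul,
      ENNReal.ofReal_pow hK.le]
    norm_num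

lemma isSubsolution_of_norm_le {m : ℕ} {lam Lam : ℝ}
    {a : Fin (m + 2) → Fin (m + 2) → Space m → ℝ} {c c₁ g g₁ u : Space m → ℝ} (hLam : 0 < Lam)
    (ha : ∀ i j, MemLp (a i j) ⊤ (muB m))
    (hbound : ∑ i, ∑ j, eLpNorm (a i j) ⊤ (muB m) ≤ ENNReal.ofReal Lam)
    (hell : ∀ᵐ x ∂(muB m), ∀ y : Space m,
      lam * ∑ i, y i ^ 2 ≤ ∑ i, ∑ j, a i j x * y i * y j)
    (hc : AEStronglyMeasurable c (muB m)) (hg : AEStronglyMeasurable g (muB m))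
    (hc₁ : AEStronglyMeasurable c₁ (sigmaN m)) (hg₁ : AEStronglyMeasurable g₁ (sigmaN m))
    (hu : MemH1 (domB m) u) (ht : IsTraceOnN u u)
    (hineq : ∀ k : ℝ, 0 ≤ k → ∀ ζ : Space m → ℝ, IsTestFunction (cubeTop m) ζ →
      (∀ x, 0 ≤ ζ x) → WeakIneq a c c₁ g g₁ u (truncTest u k ζ)) :
    IsSubsolution lam Lam a c c₁ g g₁ u := by
  refine ⟨fun i j => (ha i j).1, fun i j => ?_, hell, hc, hg, hc₁, hg₁,
    HasH1Trace.of_memH1 hu ht, hineq⟩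
  have h1 : eLpNorm (a i j) ⊤ (muB m) ≤ ENNReal.ofReal Lam := by
    refine le_trans ?_ hbound
    refine le_trans ?_ (Finset.single_le_sum (f := fun i => ∑ j, eLpNorm (a i j) ⊤ (muB m))
      (fun _ _ => zero_le) (Finset.mem_univ i))
    exact Finset.single_le_sum (f := fun j => eLpNorm (a i j) ⊤ (muB m))
      (fun _ _ => zero_le) (Finset.mem_univ j)
  rw [eLpNorm_exponent_top] at h1
  filter_upwards [ae_le_eLpNormEssSup (f := a i j) (μ := muB m)] with x hx
  have h2 := hx.trans h1
  rw [Real.enorm_eq_ofReal_abs] at h2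
  exact (ENNReal.ofReal_le_ofReal_iff hLam.le).1 h2

end CornerCube

end

/-! ### The theorem: choice of the level K. -/

/-- The dimension is `n = m + 2 ≥ 3`. A function `u ∈ H¹(B)` is represented by a function on
`B ∪ N` whose values on the (Lebesgue-null) face `N` are those of its trace; suprema are
essential suprema, for Lebesgue measure on `B` and for surface measure on `N`. The inequality
at the end is one in `[0, ∞]`. -/
theorem lemmaA7 (m : ℕ) (hm : 1 ≤ m) (lam Lam : ℝ) (hlam : 0 < lam) (hLam : 0 < Lam)
    (p p₁ q q₁ : ℝ≥0∞) (hp : 2 ≤ p) (hp₁ : 2 ≤ p₁)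
    (hq : (m : ℝ≥0∞) + 1 < q) (hq₁ : (m : ℝ≥0∞) + 1 < q₁)
    (X : Set (CornerCube.Space m)) (hX : IsCompact X)
    (hXsub : X ⊆ CornerCube.domB m ∪ CornerCube.faceN m) :
    ∃ C : ℝ, 0 < C ∧
      ∀ (a : Fin (m + 2) → Fin (m + 2) → CornerCube.Space m → ℝ)
        (c c₁ g g₁ u : CornerCube.Space m → ℝ),
        (∀ i j, MemLp (a i j) ⊤ (CornerCube.muB m)) →
        MemLp c q (CornerCube.muB m) →
        MemLp c₁ q₁ (CornerCube.sigmaN m) →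
        (∀ᵐ x ∂(CornerCube.muB m), ∀ y : CornerCube.Space m,
          lam * ∑ i, y i ^ 2 ≤ ∑ i, ∑ j, a i j x * y i * y j) →
        (∑ i, ∑ j, eLpNorm (a i j) ⊤ (CornerCube.muB m)) + eLpNorm c q (CornerCube.muB m)
            + eLpNorm c₁ q₁ (CornerCube.sigmaN m) ≤ ENNReal.ofReal Lam →
        MemLp g q (CornerCube.muB m) →
        MemLp g₁ q₁ (CornerCube.sigmaN m) →
        CornerCube.MemH1 (CornerCube.domB m) u →
        CornerCube.IsTraceOnN u u →
        (∀ k : ℝ, 0 ≤ k → ∀ ζ : CornerCube.Space m → ℝ,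
          CornerCube.IsTestFunction
            (CornerCube.unitCube m ∩ {x | 0 < x (CornerCube.idxLast m)}) ζ →
          (∀ x, 0 ≤ ζ x) →
          CornerCube.WeakIneq a c c₁ g g₁ u (CornerCube.truncTest u k ζ)) →
        eLpNorm u⁺ ⊤ (volume.restrict (X ∩ CornerCube.domB m))
            + eLpNorm u⁺ ⊤ ((CornerCube.planeMeasure m).restrict (X ∩ CornerCube.faceN m))
          ≤ ENNReal.ofReal C *
            (eLpNorm u⁺ p (CornerCube.muB m) + eLpNorm u⁺ p₁ (CornerCube.sigmaN m)
              + eLpNorm g₁ q₁ (CornerCube.sigmaN m) + eLpNorm g q (CornerCube.muB m)) := by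

  have hXU : X ⊆ CornerCube.cubeTop m := fun x hx => by
    rcases hXsub hx with h | h
    · exact ⟨h.1, h.2.1⟩
    · exact ⟨h.1, h.2.2⟩
  obtain ⟨η, hη0, hηtop, hsup⟩ :=
    CornerCube.exists_sup_bound hm hlam Lam hq hq₁ hX hXU
  obtain ⟨P, hP, hPle⟩ := CornerCube.exists_eLpNorm_le_mul (CornerCube.muB m) two_ne_zero hp
  obtain ⟨P₁, hP₁, hPle₁⟩ := CornerCube.exists_eLpNorm_le_mul (CornerCube.sigmaN m) two_ne_zero hp₁
  have hD : (P + P₁) / η ≠ ⊤ := ENNReal.div_ne_top (by finiteness) hη0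
  -- D ≥ (P + P₁)/η turns ‖u⁺‖₂ ≤ (P + P₁)R into the required ‖u⁺‖₂ ≤ ηDR, and D ≥ 1 lets K ≥ DR
  -- dominate the norms of g and g₁. In the constant 4D, one factor 2 is from the bound 2K and one
  -- from adding two suprema.
  set D : ℝ := 1 + ((P + P₁) / η).toReal with hDdef
  have hD1 : 1 ≤ D := le_add_of_nonneg_right ENNReal.toReal_nonneg
  refine ⟨4 * D, by positivity, ?_⟩
  intro a c c₁ g g₁ u ha hc hc₁ hell hbound hg hg₁ hu ht hineq
  set R : ℝ≥0∞ := eLpNorm u⁺ p (CornerCube.muB m) + eLpNorm u⁺ p₁ (CornerCube.sigmaN m)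
    + eLpNorm g₁ q₁ (CornerCube.sigmaN m) + eLpNorm g q (CornerCube.muB m) with hR
  rcases eq_or_ne R ⊤ with hRtop | hRtop
  · rw [hRtop, ENNReal.mul_top (by simp; linarith)]
    exact le_top
  have hsol := CornerCube.isSubsolution_of_norm_le hLam ha
    ((le_self_add.trans le_self_add).trans hbound) hell hc.1 hg.1 hc₁.1 hg₁.1 hu ht hineq
  have hupos : ∀ ν : Measure (CornerCube.Space m), AEStronglyMeasurable u ν →
      AEStronglyMeasurable u⁺ ν := fun ν h =>
    (by fun_prop : Continuous fun t : ℝ => max t 0).comp_aestronglyMeasurable h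
  have hu2 : eLpNorm u⁺ 2 (CornerCube.muBN m) ≤ (P + P₁) * R := by
    refine (CornerCube.eLpNorm_two_add_measure_le _ _ _).trans ?_
    rw [add_mul]
    refine add_le_add ((hPle _ (hupos _ hu.1.1)).trans ?_) ((hPle₁ _ (hupos _ ht.1.1)).trans ?_)
    · gcongr
      rw [hR, add_assoc, add_assoc]
      exact le_self_add
    · gcongr
      rw [hR, add_assoc, add_comm (eLpNorm u⁺ p _), add_assoc]
      exact le_self_add
  refine ENNReal.le_of_forall_pos_le_add fun ε hε _ => ?_
  have hε' : (0 : ℝ) < ε := hε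
  -- The level must be positive even when R = 0; the added ε/4 becomes ε in 4K and is removed at the
  -- end because ε is arbitrary.
  set K : ℝ := D * R.toReal + ε / 4 with hK
  have hKpos : 0 < K := by positivity
  have hDRK : ENNReal.ofReal D * R ≤ ENNReal.ofReal K := by
    calc ENNReal.ofReal D * R = ENNReal.ofReal (D * R.toReal) := by
          rw [ENNReal.ofReal_mul (by linarith), ENNReal.ofReal_toReal hRtop]
      _ ≤ _ := ENNReal.ofReal_le_ofReal (by linarith)
  have hRK : R ≤ ENNReal.ofReal K := by
    refine le_trans ?_ hDRK
    exact le_mul_of_one_le_left zero_le (by rwa [ENNReal.one_le_ofReal])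
  have key := hsup a c c₁ g g₁ u hsol
    ((le_add_self.trans le_self_add).trans hbound) (le_add_self.trans hbound) K hKpos
    (le_add_self.trans hRK) ((le_add_self.trans le_self_add).trans hRK) (by
      calc eLpNorm u⁺ 2 (CornerCube.muBN m) ≤ (P + P₁) * R := hu2
        _ = η * ((P + P₁) / η * R) := by
            rw [← mul_assoc, ENNReal.mul_div_cancel hη0 hηtop]
        _ ≤ η * (ENNReal.ofReal D * R) := by
            gcongr
            rw [← ENNReal.ofReal_toReal hD]
            exact ENNReal.ofReal_le_ofReal (by rw [hDdef]; linarith)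
        _ ≤ _ := by gcongr)
  have hB : volume.restrict (X ∩ CornerCube.domB m) ≤ (CornerCube.muBN m).restrict X := by
    rw [← Measure.restrict_restrict hX.measurableSet]
    exact Measure.restrict_mono le_rfl (Measure.le_add_right le_rfl)
  have hN : (CornerCube.planeMeasure m).restrict (X ∩ CornerCube.faceN m)
      ≤ (CornerCube.muBN m).restrict X := by
    rw [← Measure.restrict_restrict hX.measurableSet]
    exact Measure.restrict_mono le_rfl (Measure.le_add_left le_rfl)
  calc _ ≤ ENNReal.ofReal (2 * K) + ENNReal.ofReal (2 * K) :=
        add_le_add ((eLpNorm_mono_measure _ hB).trans key) ((eLpNorm_mono_measure _ hN).trans key)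
    _ = ENNReal.ofReal (4 * D * R.toReal + ε) := by
        rw [← ENNReal.ofReal_add (by positivity) (by positivity)]
        congr 1
        rw [hK]; ring
    _ = ENNReal.ofReal (4 * D) * R + ε := by
        rw [ENNReal.ofReal_add (by positivity) hε'.le, ENNReal.ofReal_mul (by positivity),
          ENNReal.ofReal_toReal hRtop, ENNReal.ofReal_coe_nnreal]
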